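/- **Setting.** A marked tree $t$ is a leafless, rooted, planar, locally finite tree (a set of finite words, with root the empty word $\varnothing$) with a mark $\gamma_t(x)\ge 0$ at each vertex $x$; $\nu_t(x)\geq 1$ is the number of children of $x$, $xi$ is its $i$-th child, $t[x]$ is the reindexed marked subtree from $x$, $\partial t$ is the set of rays (infinite words all of whose finite truncations $\xi_n$ are in $t$), and the space of marked trees carries the Borel $\sigma$-algebra of the local topology. A flow on $t$ is a function $\theta:t\to[0,1]$ with $\theta(\varnothing)=1$ and $\theta(x)=\sum_{i=1}^{\nu_t(x)}\theta(xi)$; it is identified with the Borel probability measure on $\partial t$ giving mass $\theta(x)$ to the set of rays through $x$. A flow rule $\Theta$ is a measurable map on a Borel set $B$ of marked trees such that for $t\in B$: $\Theta_t$ is a flow on $t$, $\Theta_t(x)>0$ for all $x\in t$, and for all $x\in t$, $t[x]\in B$ and $\Theta_{t[x]}(y)=\Theta_t(xy)/\Theta_t(x)$ for all $y\in t[x]$. It is a $\mu$-flow rule if $\mu(B)=1$; then the probability measure $\mu$ is $\Theta$-invariant if it is invariant for the Markov kernel that moves from $t$ to $t[i]$ with probability $\Theta_t(i)$, $1\le i\le\nu_t(\varnothing)$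 (the probabilities of equal subtrees being added). Let $(p_k)_{k\ge0}$ be a probability distribution with $p_0=0$, $p_1<1$ and $\sum_k kp_k<\infty$, let $\Gamma$ be a random variable with values in $(1,\infty)$, and let $\mathrm{GW}$ be the law of the marked Galton–Watson tree $T$ whose vertices have i.i.d. numbers of children with law $(p_k)$ and, independently, i.i.d. marks $\Gamma_x$ with the law of $\Gamma$. For $x\in T$ put $$|x|^\Gamma=\sum_{y\preceq x}\Big(\prod_{z\prec y}(1-\Gamma_z^{-1})\Big)\Gamma_y^{-1},$$ where $\preceq$ is the prefix order and $y$, $z$ range over words including $\varnothing$, and for distinct rays $\xi,\eta$ with greatest common prefix $\xi\wedge\eta$ put $d^\Gamma(\xi,\eta)=1-|\xi\wedge\eta|^\Gamma$ and $d^{\mathrm{nat}}(\xi,\eta)=e^{-|\xi\wedge\eta|}$ (both distances are $0$ if $\xi=\eta$). A Borel probability measure $\theta$ on $\partial t$ is exact-dimensional of dimension $D\in[0,\infty]$ for a distance $d$, written $\dim^d\theta=D$, if for $\theta$-almost every $\xi$, $\lim_{r\downarrow0}\frac{-\log\theta(B_d(\xi,r))}{-\log r}=D$, where $B_d(\xi,r)$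 is the closed ball. **Proposition.** Let $\Theta$ be a $\mathrm{GW}$-flow rule such that there is a $\Theta$-invariant probability measure $\mu$ which is absolutely continuous with respect to $\mathrm{GW}$. Then, for $\mathrm{GW}$-almost every $T$, the measure $\Theta_T$ is exact-dimensional both for $d^{\mathrm{nat}}$ and for $d^\Gamma$; the dimension $\dim^{\mathrm{nat}}\Theta_T$ with respect to $d^{\mathrm{nat}}$ is a finite deterministic constant, and the dimension with respect to $d^\Gamma$ is deterministic and equals $$\dim^{d^\Gamma}\Theta_T=\frac{\dim^{\mathrm{nat}}\Theta_T}{\mathbb E_\mu\big[-\log(1-\Gamma_\varnothing^{-1})\big]},$$ where the expectation, of the mark $\Gamma_\varnothing$ of the root under $\mu$, lies in $(0,\infty]$, and the quotient is $0$ if it is infinite. -/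

import Mathlib

open MeasureTheory Filter Topology
open scoped ENNReal NNReal

/-- The truncation `ξ_n`: the finite word made of the first `n` letters of the infinite word `ξ`.
Words are written on the alphabet `{0, 1, 2, …}`, so the children of a vertex `x` with `k` children
are `x0, x1, …, x(k-1)`. -/
def wordTrunc (ξ : ℕ → ℕ) (n : ℕ) : List ℕ := (List.range n).map ξ

/-- A leafless, rooted, planar, locally finite tree (a set of finite words), together with a
nonnegative mark on each vertex. The marks are extended by `0` off the tree, so that two marked
trees are equal as soon as they have the same vertices and the same marks on them. -/
structure MarkedTree where
  verts : Set (List ℕ)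
  mark : List ℕ → ℝ≥0
  root_mem : [] ∈ verts
  parent_mem : ∀ (x : List ℕ) (i : ℕ), x ++ [i] ∈ verts → x ∈ verts
  children : ∀ x ∈ verts, ∃ k : ℕ, 1 ≤ k ∧ ∀ i : ℕ, x ++ [i] ∈ verts ↔ i < k
  mark_off : ∀ x, x ∉ verts → mark x = 0

namespace MarkedTree

/-- The number of children of the vertex `x` in `t`. -/
noncomputable def numChildren (t : MarkedTree) (x : List ℕ) : ℕ :=
  Set.ncard {i : ℕ | x ++ [i] ∈ t.verts}

open Classical in
/-- All coordinates of a marked tree: which words are vertices, and the marks. -/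
noncomputable def coords (t : MarkedTree) : List ℕ → Bool × ℝ≥0 :=
  fun x => (decide (x ∈ t.verts), t.mark x)

/-- The local topology: since trees are locally finite, `tₙ → t` if and only if, for each height `h`,
`tₙ` and `t` have eventually the same vertices up to height `h` and the marks up to height `h`
converge (uniformly or, equivalently, pointwise). -/
noncomputable instance : TopologicalSpace MarkedTree := TopologicalSpace.induced coords inferInstance

noncomputable instance : MeasurableSpace MarkedTree := borel MarkedTree

instance : BorelSpace MarkedTree := ⟨rfl⟩

theorem measurableSpace_eq_comap :
    (inferInstance : MeasurableSpace MarkedTree) = MeasurableSpace.comap coords inferInstance := by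
  have h : (inferInstance : MeasurableSpace (List ℕ → Bool × ℝ≥0)) = borel _ :=
    BorelSpace.measurable_eq
  rw [h]
  exact borel_comap

open Classical in
/-- The reindexed subtree `t[x] = {u | xu ∈ t}`, with marks `γ_{t[x]}(u) = γ_t(xu)`
(by convention `t` itself when `x` is not a vertex of `t`). -/
noncomputable def subtree (t : MarkedTree) (x : List ℕ) : MarkedTree :=
  if hx : x ∈ t.verts then
    { verts := {u | x ++ u ∈ t.verts}
      mark := fun u => t.mark (x ++ u)
      root_mem := by simpa using hx
      parent_mem := fun u i h => t.parent_mem (x ++ u) i (by simpa using h)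
      children := fun u hu => by
        obtain ⟨k, hk, h⟩ := t.children (x ++ u) hu
        exact ⟨k, hk, fun i => by simpa using h i⟩
      mark_off := fun u hu => t.mark_off (x ++ u) hu }
  else t

/-- The boundary `∂t`: the set of rays of `t`. As a subtype of `ℕ → ℕ` it carries the topology and
the Borel σ-algebra generated by the cylinders. -/
def boundary (t : MarkedTree) : Set (ℕ → ℕ) := {ξ | ∀ n, wordTrunc ξ n ∈ t.verts}

/-- The cylinder of all rays of `t` passing through `x`. -/
def cylinder (t : MarkedTree) (x : List ℕ) : Set t.boundary :=
  {ξ | wordTrunc ξ.1 x.length = x}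

/-- A (unit) flow on the tree `t`, extended by `0` off the tree. -/
structure IsFlow (t : MarkedTree) (θ : List ℕ → ℝ) : Prop where
  mem_Icc : ∀ x ∈ t.verts, θ x ∈ Set.Icc (0 : ℝ) 1
  root : θ [] = 1
  sum_children : ∀ x ∈ t.verts, θ x = ∑ i ∈ Finset.range (t.numChildren x), θ (x ++ [i])
  off : ∀ x, x ∉ t.verts → θ x = 0

/-- The natural distance `e^{-|ξ ∧ η|}` on the boundary. For `ξ ≠ η`, `PiNat.firstDiff ξ η` is the
first index at which `ξ` and `η` differ, that is the length of their greatest common prefix. -/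
noncomputable def natDist (t : MarkedTree) (ξ η : t.boundary) : ℝ :=
  open Classical in
  if ξ = η then 0 else Real.exp (-(PiNat.firstDiff ξ.1 η.1 : ℝ))

/-- The `Γ`-height of `x`: the sum, over the prefixes `y` of `x` (including `x` and the root), of
`(∏_{z strict prefix of y} (1 - γ(z)⁻¹)) γ(y)⁻¹`. -/
noncomputable def gammaHeight (t : MarkedTree) (x : List ℕ) : ℝ :=
  ∑ k ∈ Finset.range (x.length + 1),
    (∏ j ∈ Finset.range k, (1 - (t.mark (x.take j) : ℝ)⁻¹)) * (t.mark (x.take k) : ℝ)⁻¹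

/-- The length distance `1 - |ξ ∧ η|^Γ` on the boundary. -/
noncomputable def gammaDist (t : MarkedTree) (ξ η : t.boundary) : ℝ :=
  open Classical in
  if ξ = η then 0 else 1 - t.gammaHeight (wordTrunc ξ.1 (PiNat.firstDiff ξ.1 η.1))

end MarkedTree

/-- The measure `M` is a probability measure which is exact-dimensional of dimension `D ∈ [0, ∞]`
for the distance function `d`: for `M`-almost every `ξ`, `(-log M(B(ξ, r))) / (-log r)` tends to `D`
as `r ↓ 0`, where `B(ξ, r)` is the closed ball. -/
def IsExactDimensional {X : Type*} [MeasurableSpace X] (d : X → X → ℝ) (M : Measure X)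
    (D : ℝ≥0∞) : Prop :=
  IsProbabilityMeasure M ∧
    ∀ᵐ ξ ∂M, Tendsto
      (fun r : ℝ => -(ENNReal.log (M {η | d ξ η ≤ r})) / ((-Real.log r : ℝ) : EReal))
      (𝓝[>] 0) (𝓝 (D : EReal))

/-- The flow `θ` on `t` is exact-dimensional of dimension `D` for the distance `d` on the boundary:
so is the (unique) Borel probability measure `M` on the boundary such that `M` of the cylinder of
`x` is `θ x` for each vertex `x`. -/
def MarkedTree.FlowExactDimensional (t : MarkedTree) (d : t.boundary → t.boundary → ℝ)
    (θ : List ℕ → ℝ) (D : ℝ≥0∞) : Prop :=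
  ∃ M : Measure t.boundary,
    (∀ x ∈ t.verts, M (t.cylinder x) = ENNReal.ofReal (θ x)) ∧ IsExactDimensional d M D

/-- A (consistent) flow rule, defined on a Borel set `dom` of marked trees; the values of `flow`
outside `dom` are irrelevant. -/
structure FlowRule where
  dom : Set MarkedTree
  measurableSet_dom : MeasurableSet dom
  flow : MarkedTree → List ℕ → ℝ
  measurable_flow : ∀ x : List ℕ, Measurable (fun t : dom => flow t x)
  isFlow : ∀ t ∈ dom, t.IsFlow (flow t)
  pos : ∀ t ∈ dom, ∀ x ∈ t.verts, 0 < flow t x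
  subtree_mem : ∀ t ∈ dom, ∀ x ∈ t.verts, t.subtree x ∈ dom
  consistent : ∀ t ∈ dom, ∀ x ∈ t.verts, ∀ y ∈ (t.subtree x).verts,
    flow (t.subtree x) y = flow t (x ++ y) / flow t x

/-- `Θ` is a `μ`-flow rule: its domain has full `μ`-measure. -/
def FlowRule.IsRuleFor (Θ : FlowRule) (μ : Measure MarkedTree) : Prop := μ Θ.domᶜ = 0

open Classical in
/-- `μ` is `Θ`-invariant: `Θ` is a `μ`-flow rule and `μ P_Θ = μ`, where the transition kernel `P_Θ`
moves from `t` to the subtree `t[i]` of the `i`-th child of the root with probability `Θ_t(i)`. -/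
def FlowRule.IsInvariant (Θ : FlowRule) (μ : Measure MarkedTree) : Prop :=
  Θ.IsRuleFor μ ∧ ∀ A : Set MarkedTree, MeasurableSet A →
    ∫⁻ t, ∑ i ∈ Finset.range (t.numChildren []),
      (if t.subtree [i] ∈ A then ENNReal.ofReal (Θ.flow t [i]) else 0) ∂μ = μ A

namespace GaltonWatson

open Classical in
/-- The marked tree in which each vertex `x` has `(ω x).1` children and mark `(ω x).2`. (The number
of children is replaced by `1` if `(ω x).1 = 0`; this has probability `0` when `p 0 = 0`.) -/
noncomputable def tree (ω : List ℕ → ℕ × ℝ≥0) : MarkedTree where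
  verts := {x | ∀ (y : List ℕ) (i : ℕ), (y ++ [i]) <+: x → i < max 1 (ω y).1}
  mark := fun x =>
    if ∀ (y : List ℕ) (i : ℕ), (y ++ [i]) <+: x → i < max 1 (ω y).1 then (ω x).2 else 0
  root_mem := fun y i h => by simp at h
  parent_mem := fun x i h y j hy => h y j (hy.trans (List.prefix_append x [i]))
  children := fun x hx => by
    refine ⟨max 1 (ω x).1, le_max_left _ _, fun i => ⟨fun h => h x i List.prefix_rfl, ?_⟩⟩
    intro hi y j hy
    rcases List.prefix_concat_iff.1 hy with h | h
    · obtain ⟨rfl, h2⟩ := List.append_inj' h rfl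
      simp only [List.cons.injEq, and_true] at h2
      exact h2 ▸ hi
    · exact hx y j h
  mark_off := fun x hx => if_neg hx

theorem measurable_tree : Measurable tree := by
  have hS : ∀ x : List ℕ, MeasurableSet {ω : List ℕ → ℕ × ℝ≥0 | x ∈ (tree ω).verts} := by
    intro x
    have : {ω : List ℕ → ℕ × ℝ≥0 | x ∈ (tree ω).verts} =
        ⋂ y : List ℕ, ⋂ i : ℕ, ⋂ _ : (y ++ [i]) <+: x, {ω | i < max 1 (ω y).1} := by
      ext ω
      simp [tree]
    rw [this]
    refine MeasurableSet.iInter fun y => MeasurableSet.iInter fun i => MeasurableSet.iInter fun _ => ?_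
    have hm : Measurable fun ω : List ℕ → ℕ × ℝ≥0 => (ω y).1 :=
      measurable_fst.comp (measurable_pi_apply y)
    exact hm (MeasurableSet.of_discrete (s := {n : ℕ | i < max 1 n}))
  have hc : Measurable fun ω => (tree ω).coords := by
    refine measurable_pi_lambda _ fun x => Measurable.prodMk ?_ ?_
    · refine measurable_to_bool ?_
      convert hS x using 1
      ext ω
      simp
    · classical
      exact Measurable.ite (hS x) (measurable_snd.comp (measurable_pi_apply x)) measurable_const
  have h := MarkedTree.measurableSpace_eq_comap
  rw [measurable_iff_comap_le]
  calc MeasurableSpace.comap tree inferInstance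
      = MeasurableSpace.comap tree (MeasurableSpace.comap MarkedTree.coords inferInstance) := by
        rw [← h]
    _ = MeasurableSpace.comap (fun ω => (tree ω).coords) inferInstance :=
        MeasurableSpace.comap_comp
    _ ≤ _ := hc.comap_le

/-- The law of the marked Galton-Watson tree with reproduction law `p` and mark law `η`: the numbers
of children and the marks are all independent, with laws `p` and `η`. -/
noncomputable def law (p : PMF ℕ) (η : Measure ℝ≥0) : Measure MarkedTree :=
  Measure.map tree (Measure.infinitePi fun _ : List ℕ => p.toMeasure.prod η)

theorem isProbabilityMeasure_law (p : PMF ℕ) (η : Measure ℝ≥0) [IsProbabilityMeasure η] :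
    IsProbabilityMeasure (law p η) :=
  Measure.isProbabilityMeasure_map measurable_tree.aemeasurable

end GaltonWatson

/-! Draw a tree from `μ`, then a ray `ξ` of it from the flow, and shift the pair along the ray.
Invariance of `μ` says that this shift preserves the joint law, and the theorem is the pointwise
ergodic theorem for it. By consistency, `-log` of the mass of `ξ_n` is a Birkhoff sum. As `1 -
|ξ_n|^Γ` telescopes to the product of the factors `1 - 1/γ` along `ξ_n`, its `-log` is a Birkhoff
sum too. The two averages converge to constants `D` and `E`. A ball around `ξ` is a cylinder, at the
first height where the logarithmic size reaches `-log r`, so the dimension is `D / E`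
(`tendsto_div_of_first_passage`, `flowExactDimensional`). The natural distance is the case `E = 1`.

Ergodicity and the passage from `μ` to the Galton-Watson law both rest on the zero-one law
`law_eq_zero_or_one` for properties inherited by the children. The set where the density of `μ` is
positive is inherited, so the two measures are equivalent. For a shift-invariant event, the
conditional probability given the tree is a bounded harmonic function. It is therefore constant
along edges, then almost surely a constant `c`; given the first letters of the ray it is still `c`,
so the event is independent of itself.

Integrability of the logarithmic losses is not assumed. The ergodic theorem is therefore proved for
nonnegative functions with mean in `[0, ∞]`. Finiteness of `D` comes from
`exists_le_flow_wordTrunc`: the expected inverse mass of `ξ_n` is at most the mean number of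
vertices at height `n`, which is exponential in `n`. Finally `E ≠ 0` because the marks exceed `1`,
and `E = ∞` is allowed. -/

section Birkhoff

/-! ### Maximal inequality and pointwise ergodic theorem. -/

variable {α : Type*} {f : α → α} {g : α → ℝ}

/-- The maximum of `0` and of the first `n` Birkhoff sums. -/
noncomputable def birkhoffMax (f : α → α) (g : α → ℝ) : ℕ → α → ℝ
  | 0, _ => 0
  | n + 1, x => max 0 (g x + birkhoffMax f g n (f x))

theorem birkhoffMax_nonneg (n : ℕ) (x : α) : 0 ≤ birkhoffMax f g n x := by
  cases n with
  | zero => exact le_rfl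
  | succ n => exact le_max_left _ _

theorem birkhoffMax_le_succ (n : ℕ) (x : α) : birkhoffMax f g n x ≤ birkhoffMax f g (n + 1) x := by
  induction n generalizing x with
  | zero => exact birkhoffMax_nonneg _ _
  | succ n ih =>
    rw [birkhoffMax, birkhoffMax]
    gcongr
    exact ih _

theorem birkhoffSum_le_birkhoffMax (n : ℕ) (x : α) : birkhoffSum f g n x ≤ birkhoffMax f g n x := by
  induction n generalizing x with
  | zero => simp [birkhoffMax]
  | succ n ih =>
    rw [birkhoffSum_succ', birkhoffMax]
    exact (add_le_add le_rfl (ih _)).trans (le_max_right _ _)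

variable [MeasurableSpace α] {μ : Measure α}

theorem measurable_birkhoffMax (hf : Measurable f) (hg : Measurable g) (n : ℕ) :
    Measurable (birkhoffMax f g n) := by
  induction n with
  | zero => exact measurable_const
  | succ n ih => exact measurable_const.max (hg.add (ih.comp hf))

theorem measurable_birkhoffSum (hf : Measurable f) (hg : Measurable g) (n : ℕ) :
    Measurable (birkhoffSum f g n) :=
  Finset.measurable_sum _ fun i _ => hg.comp (hf.iterate i)

theorem integrable_birkhoffMax (hf : MeasurePreserving f μ μ) (hgi : Integrable g μ) (n : ℕ) :
    Integrable (birkhoffMax f g n) μ := by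
  induction n with
  | zero => exact integrable_zero _ _ _
  | succ n ih =>
    have h := (hgi.add (hf.integrable_comp_of_integrable ih)).pos_part
    refine h.congr (Eventually.of_forall fun x => ?_)
    simp [birkhoffMax, max_comm]

/-- Hopf's maximal ergodic inequality. -/
theorem integral_indicator_birkhoffMax_nonneg (hf : MeasurePreserving f μ μ) (hg : Measurable g)
    (hgi : Integrable g μ) (n : ℕ) :
    0 ≤ ∫ x, {x | 0 < birkhoffMax f g n x}.indicator g x ∂μ := by
  cases n with
  | zero => simp [birkhoffMax]
  | succ n =>
    have hset : MeasurableSet {x | 0 < birkhoffMax f g (n + 1) x} :=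
      measurableSet_lt measurable_const (measurable_birkhoffMax hf.measurable hg _)
    have hi := integrable_birkhoffMax hf hgi n
    have hi' := hf.integrable_comp_of_integrable hi
    calc (0 : ℝ) ≤ ∫ x, birkhoffMax f g (n + 1) x ∂μ - ∫ x, birkhoffMax f g n x ∂μ :=
          sub_nonneg.2 (integral_mono hi (integrable_birkhoffMax hf hgi _)
            fun x => birkhoffMax_le_succ n x)
      _ = ∫ x, birkhoffMax f g (n + 1) x ∂μ - ∫ x, birkhoffMax f g n (f x) ∂μ := by
          congr 1
          have := integral_map hf.measurable.aemeasurable (μ := μ) (f := birkhoffMax f g n)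
            (measurable_birkhoffMax hf.measurable hg n).aestronglyMeasurable
          rw [hf.map_eq] at this
          exact this
      _ = ∫ x, (birkhoffMax f g (n + 1) x - birkhoffMax f g n (f x)) ∂μ :=
          (integral_sub (integrable_birkhoffMax hf hgi _) hi').symm
      _ ≤ _ := by
          -- With `M_n` the maxima, `g = M_{n+1} - M_n ∘ f` where `M_{n+1} > 0`; elsewhere `M_{n+1}
          -- = 0` and the difference is nonpositive.
          refine integral_mono ((integrable_birkhoffMax hf hgi _).sub hi')
            (hgi.indicator hset) fun x => ?_
          by_cases hx : 0 < birkhoffMax f g (n + 1) x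
          · rw [Set.indicator_of_mem (s := {x | 0 < birkhoffMax f g (n + 1) x}) hx]
            have : birkhoffMax f g (n + 1) x = g x + birkhoffMax f g n (f x) := by
              rw [birkhoffMax] at hx ⊢
              exact max_eq_right ((lt_max_iff.1 hx).resolve_left (lt_irrefl _)).le
            simp [this]
          · rw [Set.indicator_of_notMem (s := {x | 0 < birkhoffMax f g (n + 1) x}) hx]
            have := birkhoffMax_nonneg (f := f) (g := g) n (f x)
            simp only [not_lt] at hx
            linarith

/-- A positive Birkhoff sum keeps all later maxima positive, so the sets in Hopf's inequality
increase to a set of full measure and dominated convergence removes the indicator. -/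
theorem integral_nonneg_of_ae_exists_birkhoffSum_pos (hf : MeasurePreserving f μ μ)
    (hg : Measurable g) (hgi : Integrable g μ) (h : ∀ᵐ x ∂μ, ∃ n, 0 < birkhoffSum f g n x) :
    0 ≤ ∫ x, g x ∂μ := by
  have hlim : Tendsto (fun n => ∫ x, {x | 0 < birkhoffMax f g n x}.indicator g x ∂μ) atTop
      (𝓝 (∫ x, g x ∂μ)) := by
    refine tendsto_integral_of_dominated_convergence (fun x => ‖g x‖) (fun n => ?_) hgi.norm
      (fun n => Eventually.of_forall fun x => norm_indicator_le_norm_self _ _) ?_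
    · exact (hg.indicator (measurableSet_lt measurable_const
        (measurable_birkhoffMax hf.measurable hg _))).aestronglyMeasurable
    · filter_upwards [h] with x ⟨n, hn⟩
      refine tendsto_const_nhds.congr' ?_
      filter_upwards [eventually_ge_atTop n] with m hm
      have : 0 < birkhoffMax f g m x :=
        (hn.trans_le (birkhoffSum_le_birkhoffMax n x)).trans_le
          (monotone_nat_of_le_succ (fun k => birkhoffMax_le_succ (f := f) (g := g) k x) hm)
      rw [Set.indicator_of_mem (s := {x | 0 < birkhoffMax f g m x}) this]
  exact ge_of_tendsto' hlim fun n => integral_indicator_birkhoffMax_nonneg hf hg hgi n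

/-- Applying `f` changes the sums only by the fixed amount `g x`, so unboundedness is an invariant
event. If it had full measure, the preceding inequality would give a nonnegative integral. -/
theorem Ergodic.ae_bddAbove_birkhoffSum (hf : Ergodic f μ) (hg : Measurable g)
    (hgi : Integrable g μ) (hneg : ∫ x, g x ∂μ < 0) :
    ∀ᵐ x ∂μ, ∃ K : ℝ, ∀ n, birkhoffSum f g n x ≤ K := by
  set A : Set α := {x | ∀ K : ℕ, ∃ n, (K : ℝ) < birkhoffSum f g n x} with hA
  have hAm : MeasurableSet A := by
    have : A = ⋂ K : ℕ, ⋃ n, {x | (K : ℝ) < birkhoffSum f g n x} := by ext; simp [hA]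
    rw [this]
    exact MeasurableSet.iInter fun K => MeasurableSet.iUnion fun n =>
      measurableSet_lt measurable_const (measurable_birkhoffSum hf.measurable hg n)
  have hAi : f ⁻¹' A = A := by
    ext x
    simp only [Set.mem_preimage, hA, Set.mem_ofPred_eq]
    constructor
    · intro h K
      obtain ⟨L, hL⟩ := exists_nat_gt (|g x| + K)
      obtain ⟨n, hn⟩ := h L
      refine ⟨n + 1, ?_⟩
      rw [birkhoffSum_succ']
      linarith [neg_abs_le (g x)]
    · intro h K
      obtain ⟨L, hL⟩ := exists_nat_gt (|g x| + K)
      obtain ⟨n, hn⟩ := h L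
      cases n with
      | zero =>
        simp only [birkhoffSum_zero] at hn
        exact absurd hn (not_lt.2 L.cast_nonneg)
      | succ n =>
        refine ⟨n, ?_⟩
        rw [birkhoffSum_succ'] at hn
        linarith [le_abs_self (g x)]
  rcases hf.toPreErgodic.ae_mem_or_ae_notMem hAm hAi with h | h
  · refine absurd (integral_nonneg_of_ae_exists_birkhoffSum_pos hf.toMeasurePreserving hg hgi ?_)
      (not_le.2 hneg)
    filter_upwards [h] with x hx
    simpa using hx 0
  · filter_upwards [h] with x hx
    simp only [hA, Set.mem_ofPred_eq, not_forall, not_exists, not_lt] at hx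
    obtain ⟨K, hK⟩ := hx
    exact ⟨K, hK⟩

/-- Centre `g` at some `c'` strictly between its mean and `c`: the centred sums are bounded above,
and `(c - c') * n` eventually exceeds the bound. -/
theorem Ergodic.ae_eventually_birkhoffSum_le [IsProbabilityMeasure μ] (hf : Ergodic f μ)
    (hg : Measurable g) (hgi : Integrable g μ) {c : ℝ} (hc : ∫ x, g x ∂μ < c) :
    ∀ᵐ x ∂μ, ∀ᶠ n : ℕ in atTop, birkhoffSum f g n x ≤ c * n := by
  obtain ⟨c', hc1, hc2⟩ := exists_between hc
  have h := hf.ae_bddAbove_birkhoffSum (g := fun x => g x - c') (hg.sub_const _)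
    (hgi.sub (integrable_const _)) (by
      rw [integral_sub hgi (integrable_const _)]
      simpa using hc1)
  filter_upwards [h] with x ⟨K, hK⟩
  have hlim : Tendsto (fun n : ℕ => (c - c') * (n : ℝ)) atTop atTop :=
    tendsto_natCast_atTop_atTop.const_mul_atTop (sub_pos.2 hc2)
  filter_upwards [hlim.eventually_ge_atTop K] with n hn
  have h1 := hK n
  have h2 : birkhoffSum f (fun x => g x - c') n x = birkhoffSum f g n x - n * c' := by
    simp [birkhoffSum, Finset.sum_sub_distrib]
  rw [h2] at h1
  linarith

theorem Ergodic.ae_eventually_le_birkhoffSum [IsProbabilityMeasure μ] (hf : Ergodic f μ)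
    (hg : Measurable g) (hgi : Integrable g μ) {c : ℝ} (hc : c < ∫ x, g x ∂μ) :
    ∀ᵐ x ∂μ, ∀ᶠ n : ℕ in atTop, c * n ≤ birkhoffSum f g n x := by
  have h := hf.ae_eventually_birkhoffSum_le (g := fun x => -g x) (c := -c) hg.neg hgi.neg
    (by rw [integral_neg]; linarith)
  filter_upwards [h] with x hx
  filter_upwards [hx] with n hn
  have : birkhoffSum f (fun x => -g x) n x = -birkhoffSum f g n x := by simp [birkhoffSum]
  rw [this] at hn
  linarith

/-- The pointwise ergodic theorem for a nonnegative function, of finite or infinite mean. -/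
theorem Ergodic.ae_tendsto_birkhoffAverage [IsProbabilityMeasure μ] (hf : Ergodic f μ)
    (hg : Measurable g) (h0 : ∀ x, 0 ≤ g x) :
    ∀ᵐ x ∂μ, Tendsto (fun n : ℕ => ENNReal.ofReal (birkhoffSum f g n x / n)) atTop
      (𝓝 (∫⁻ x, ENNReal.ofReal (g x) ∂μ)) := by
  set L := ∫⁻ x, ENNReal.ofReal (g x) ∂μ with hL
  have hlow : ∀ c : ℝ≥0, (c : ℝ≥0∞) < L →
      ∀ᵐ x ∂μ, ∀ᶠ n : ℕ in atTop, (c : ℝ≥0∞) ≤ ENNReal.ofReal (birkhoffSum f g n x / n) := by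
    intro c hc
    -- Truncation at `N` makes the function integrable; monotone convergence recovers the lower
    -- bound even when `L = ∞`.
    have hsup : L = ⨆ N : ℕ, ∫⁻ x, ENNReal.ofReal (min (g x) N) ∂μ := by
      rw [← lintegral_iSup (fun N => (hg.min measurable_const).ennreal_ofReal)]
      · refine lintegral_congr fun x => le_antisymm ?_ (iSup_le fun N =>
          ENNReal.ofReal_le_ofReal (min_le_left _ _))
        obtain ⟨N, hN⟩ := exists_nat_ge (g x)
        exact le_iSup_of_le N (by rw [min_eq_left hN])
      · intro a b hab x
        exact ENNReal.ofReal_le_ofReal (min_le_min le_rfl (by exact_mod_cast hab))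
    rw [hsup, lt_iSup_iff] at hc
    obtain ⟨N, hN⟩ := hc
    have hm : Measurable fun x => min (g x) N := hg.min measurable_const
    have hi : Integrable (fun x => min (g x) (N : ℝ)) μ := by
      refine Integrable.of_bound hm.aestronglyMeasurable N (Eventually.of_forall fun x => ?_)
      rw [Real.norm_of_nonneg (le_min (h0 x) N.cast_nonneg)]
      exact min_le_right _ _
    have h0' : ∀ x, 0 ≤ min (g x) (N : ℝ) := fun x => le_min (h0 x) N.cast_nonneg
    rw [← ofReal_integral_eq_lintegral_ofReal hi (Eventually.of_forall h0'),
      ← ENNReal.ofReal_coe_nnreal] at hN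
    replace hN := (ENNReal.ofReal_lt_ofReal_iff_of_nonneg c.2).1 hN
    filter_upwards [hf.ae_eventually_le_birkhoffSum hm hi hN] with x hx
    filter_upwards [hx, eventually_gt_atTop 0] with n hn hn0
    rw [← ENNReal.ofReal_coe_nnreal]
    refine ENNReal.ofReal_le_ofReal ?_
    rw [le_div_iff₀ (by exact_mod_cast hn0)]
    exact hn.trans (Finset.sum_le_sum fun i _ => min_le_left _ _)
  have hup : ∀ c : ℝ≥0, L < c →
      ∀ᵐ x ∂μ, ∀ᶠ n : ℕ in atTop, ENNReal.ofReal (birkhoffSum f g n x / n) ≤ c := by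
    intro c hc
    have hi : Integrable g μ :=
      ⟨hg.aestronglyMeasurable, by
        rw [hasFiniteIntegral_iff_ofReal (Eventually.of_forall h0)]
        exact hc.trans ENNReal.coe_lt_top⟩
    rw [hL, ← ofReal_integral_eq_lintegral_ofReal hi (Eventually.of_forall h0),
      ← ENNReal.ofReal_coe_nnreal] at hc
    replace hc := (ENNReal.ofReal_lt_ofReal_iff_of_nonneg (integral_nonneg h0)).1 hc
    filter_upwards [hf.ae_eventually_birkhoffSum_le hg hi hc] with x hx
    filter_upwards [hx, eventually_gt_atTop 0] with n hn hn0
    rw [← ENNReal.ofReal_coe_nnreal]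
    refine ENNReal.ofReal_le_ofReal ?_
    rw [div_le_iff₀ (by exact_mod_cast hn0)]
    exact hn
  -- Rational levels give a single null set for all the bounds.
  have hlow' : ∀ᵐ x ∂μ, ∀ q : ℚ, (Real.toNNReal q : ℝ≥0∞) < L → ∀ᶠ n : ℕ in atTop,
      (Real.toNNReal q : ℝ≥0∞) ≤ ENNReal.ofReal (birkhoffSum f g n x / n) := by
    rw [ae_all_iff]
    intro q
    by_cases h : (Real.toNNReal q : ℝ≥0∞) < L
    · filter_upwards [hlow _ h] with x hx _ using hx
    · exact Eventually.of_forall fun x h' => absurd h' h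
  have hup' : ∀ᵐ x ∂μ, ∀ q : ℚ, L < (Real.toNNReal q : ℝ≥0∞) → ∀ᶠ n : ℕ in atTop,
      ENNReal.ofReal (birkhoffSum f g n x / n) ≤ (Real.toNNReal q : ℝ≥0∞) := by
    rw [ae_all_iff]
    intro q
    by_cases h : L < (Real.toNNReal q : ℝ≥0∞)
    · filter_upwards [hup _ h] with x hx _ using hx
    · exact Eventually.of_forall fun x h' => absurd h' h
  filter_upwards [hlow', hup'] with x h1 h2
  refine tendsto_order.2 ⟨fun a ha => ?_, fun a ha => ?_⟩
  · obtain ⟨q, _, hq1, hq2⟩ := ENNReal.lt_iff_exists_rat_btwn.1 ha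
    filter_upwards [h1 q hq2] with n hn using hq1.trans_le hn
  · obtain ⟨q, _, hq1, hq2⟩ := ENNReal.lt_iff_exists_rat_btwn.1 ha
    filter_upwards [h2 q hq1] with n hn using hn.trans_lt hq2

end Birkhoff

/-! ### Cylinders, and the measure on infinite words defined by a flow. -/

section Words

open ProbabilityTheory

@[simp] theorem length_wordTrunc (ξ : ℕ → ℕ) (n : ℕ) : (wordTrunc ξ n).length = n := by
  simp [wordTrunc]

@[simp] theorem wordTrunc_zero (ξ : ℕ → ℕ) : wordTrunc ξ 0 = [] := rfl

theorem wordTrunc_succ (ξ : ℕ → ℕ) (n : ℕ) : wordTrunc ξ (n + 1) = wordTrunc ξ n ++ [ξ n] := by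
  simp [wordTrunc, List.range_succ]

theorem wordTrunc_add (ξ : ℕ → ℕ) (n m : ℕ) :
    wordTrunc ξ (n + m) = wordTrunc ξ n ++ wordTrunc (fun k => ξ (n + k)) m := by
  induction m with
  | zero => simp
  | succ m ih => rw [← add_assoc, wordTrunc_succ, ih, wordTrunc_succ, List.append_assoc]

theorem take_wordTrunc (ξ : ℕ → ℕ) {k n : ℕ} (h : k ≤ n) :
    (wordTrunc ξ n).take k = wordTrunc ξ k := by
  obtain ⟨m, rfl⟩ := Nat.exists_eq_add_of_le h
  rw [wordTrunc_add, List.take_left' (length_wordTrunc ξ k)]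

theorem wordTrunc_eq_iff {ξ ζ : ℕ → ℕ} {n : ℕ} :
    wordTrunc ξ n = wordTrunc ζ n ↔ ∀ k < n, ξ k = ζ k := by
  simp [wordTrunc]

/-- The set of infinite words with prefix `x`. -/
def wordCylinder (x : List ℕ) : Set (ℕ → ℕ) := {ξ | wordTrunc ξ x.length = x}

theorem mem_wordCylinder {x : List ℕ} {ξ : ℕ → ℕ} :
    ξ ∈ wordCylinder x ↔ wordTrunc ξ x.length = x := Iff.rfl

theorem mem_wordCylinder_wordTrunc {ξ ζ : ℕ → ℕ} {n : ℕ} :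
    ζ ∈ wordCylinder (wordTrunc ξ n) ↔ wordTrunc ζ n = wordTrunc ξ n := by
  rw [mem_wordCylinder, length_wordTrunc]

@[simp] theorem wordCylinder_nil : wordCylinder [] = Set.univ := by
  ext ξ
  simp [mem_wordCylinder]

theorem mem_wordCylinder_append {x y : List ℕ} {ξ : ℕ → ℕ} :
    ξ ∈ wordCylinder (x ++ y) ↔
      ξ ∈ wordCylinder x ∧ (fun k => ξ (x.length + k)) ∈ wordCylinder y := by
  simp only [mem_wordCylinder, List.length_append, wordTrunc_add]
  exact ⟨fun h => List.append_inj h (by simp), fun ⟨h1, h2⟩ => by rw [h1, h2]⟩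

theorem mem_wordCylinder_concat {x : List ℕ} {i : ℕ} {ξ : ℕ → ℕ} :
    ξ ∈ wordCylinder (x ++ [i]) ↔ ξ ∈ wordCylinder x ∧ ξ x.length = i := by
  rw [mem_wordCylinder_append]
  simp [mem_wordCylinder, wordTrunc_succ]

theorem measurableSet_wordCylinder (x : List ℕ) : MeasurableSet (wordCylinder x) := by
  induction x using List.reverseRecOn with
  | nil => simp
  | append_singleton x i ih =>
    have : wordCylinder (x ++ [i]) = wordCylinder x ∩ (fun ξ => ξ x.length) ⁻¹' {i} := by
      ext ξ
      exact mem_wordCylinder_concat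
    rw [this]
    exact ih.inter (measurable_pi_apply _ (measurableSet_singleton i))

theorem measurable_comp_wordTrunc {β : Type*} [MeasurableSpace β] (F : List ℕ → β) (n : ℕ) :
    Measurable fun ξ => F (wordTrunc ξ n) := by
  intro s _
  have : (fun ξ => F (wordTrunc ξ n)) ⁻¹' s =
      ⋃ x ∈ {x : List ℕ | x.length = n ∧ F x ∈ s}, wordCylinder x := by
    ext ξ
    simp only [Set.mem_preimage, Set.mem_iUnion, Set.mem_ofPred_eq, exists_prop, mem_wordCylinder]
    constructor
    · intro h
      exact ⟨wordTrunc ξ n, ⟨by simp, h⟩, by simp⟩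
    · rintro ⟨x, ⟨rfl, h⟩, hx⟩
      rwa [hx]
  rw [this]
  exact MeasurableSet.biUnion (Set.to_countable _) fun x _ => measurableSet_wordCylinder x

theorem generateFrom_wordCylinder :
    (inferInstance : MeasurableSpace (ℕ → ℕ)) =
      MeasurableSpace.generateFrom (Set.range wordCylinder) := by
  refine le_antisymm ?_ ?_
  · refine iSup_le fun n => ?_
    rw [← measurable_iff_comap_le]
    refine @measurable_to_countable' _ _ _ _
      (MeasurableSpace.generateFrom (Set.range wordCylinder)) _ fun i => ?_
    have : (fun ξ : ℕ → ℕ => ξ n) ⁻¹' {i} =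
        ⋃ x : List ℕ, ⋃ _ : x.length = n, wordCylinder (x ++ [i]) := by
      ext ξ
      simp only [Set.mem_preimage, Set.mem_singleton_iff, Set.mem_iUnion, mem_wordCylinder_concat]
      constructor
      · intro h
        exact ⟨wordTrunc ξ n, by simp, by simp [mem_wordCylinder], by simpa using h⟩
      · rintro ⟨x, rfl, -, h⟩
        exact h
    rw [this]
    exact MeasurableSet.iUnion fun x => MeasurableSet.iUnion fun _ =>
      MeasurableSpace.measurableSet_generateFrom ⟨_, rfl⟩
  · refine MeasurableSpace.generateFrom_le ?_
    rintro _ ⟨x, rfl⟩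
    exact measurableSet_wordCylinder x

theorem isPiSystem_wordCylinder : IsPiSystem (Set.range wordCylinder) := by
  have key : ∀ x y : List ℕ, x.length ≤ y.length → (wordCylinder x ∩ wordCylinder y).Nonempty →
      wordCylinder x ∩ wordCylinder y = wordCylinder y := by
    rintro x y hxy ⟨ξ, hx, hy⟩
    refine Set.inter_eq_right.2 fun ζ hζ => ?_
    rw [mem_wordCylinder] at *
    rw [← take_wordTrunc ζ hxy, hζ, ← hy, take_wordTrunc ξ hxy, hx]
  rintro _ ⟨x, rfl⟩ _ ⟨y, rfl⟩ h
  rcases le_total x.length y.length with hxy | hxy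
  · exact ⟨y, (key x y hxy h).symm⟩
  · rw [Set.inter_comm] at h ⊢
    exact ⟨x, (key y x hxy h).symm⟩

theorem measure_ext_of_wordCylinder {m m' : Measure (ℕ → ℕ)} [IsFiniteMeasure m]
    (h : ∀ x, m (wordCylinder x) = m' (wordCylinder x)) : m = m' := by
  refine ext_of_generate_finite _ generateFrom_wordCylinder isPiSystem_wordCylinder ?_ ?_
  · rintro _ ⟨x, rfl⟩
    exact h x
  · simpa using h []

/-- The law of the next letter after the word `x` under the unit flow `θ`. -/
noncomputable def nextLetter (θ : List ℕ → ℝ≥0∞) (x : List ℕ) : Measure ℕ :=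
  open Classical in
  -- A default value which keeps this a probability measure for every `x`, as a Markov kernel
  -- requires.
  if θ x = 0 ∨ θ x = ∞ then Measure.dirac 0
  else (θ x)⁻¹ • Measure.sum fun i => θ (x ++ [i]) • Measure.dirac i

theorem isProbabilityMeasure_nextLetter {θ : List ℕ → ℝ≥0∞}
    (hs : ∀ x, θ x = ∑' i, θ (x ++ [i])) (x : List ℕ) :
    IsProbabilityMeasure (nextLetter θ x) := by
  unfold nextLetter
  split_ifs with h
  · infer_instance
  · push Not at h
    refine ⟨?_⟩
    simp only [Measure.smul_apply, smul_eq_mul, Measure.sum_apply _ MeasurableSet.univ,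
      Measure.dirac_apply_of_mem (Set.mem_univ _), mul_one]
    rw [← hs, ENNReal.inv_mul_cancel h.1 h.2]

theorem mul_nextLetter_singleton {θ : List ℕ → ℝ≥0∞} (hs : ∀ x, θ x = ∑' i, θ (x ++ [i]))
    {x : List ℕ} (hx : θ x ≠ ∞) (i : ℕ) : θ x * nextLetter θ x {i} = θ (x ++ [i]) := by
  unfold nextLetter
  split_ifs with h
  · have h0 := h.resolve_right hx
    have : ∑' i, θ (x ++ [i]) = 0 := by rw [← hs, h0]
    rw [h0, zero_mul, ENNReal.tsum_eq_zero.1 this i]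
  · push Not at h
    have : (Measure.sum fun i => θ (x ++ [i]) • Measure.dirac i) {i} = θ (x ++ [i]) := by
      rw [Measure.sum_apply _ (measurableSet_singleton i), tsum_eq_single i]
      · simp
      · intro j hj
        simp [hj]
    rw [Measure.smul_apply, this, smul_eq_mul, ← mul_assoc, ENNReal.mul_inv_cancel h.1 h.2, one_mul]

/-- A nonnegative unit flow on the tree of all words defines a probability measure on the set of
infinite words. -/
theorem exists_measure_wordCylinder {θ : List ℕ → ℝ≥0∞} (h1 : θ [] = 1)
    (hs : ∀ x, θ x = ∑' i, θ (x ++ [i])) :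
    ∃ m : Measure (ℕ → ℕ), IsProbabilityMeasure m ∧ ∀ x, m (wordCylinder x) = θ x := by
  have hfin : ∀ x, θ x ≠ ∞ := fun x => by
    induction x using List.reverseRecOn with
    | nil => simp [h1]
    | append_singleton x i ih =>
      refine ne_top_of_le_ne_top ih ?_
      rw [hs x]
      exact ENNReal.le_tsum i
  -- Ionescu-Tulcea with a shift of one: coordinate `0` of the trajectory is a dummy, and letter `k`
  -- is coordinate `k + 1`. Thus the history up to time `n` contains exactly `n` letters, completed
  -- here by `0`.
  let ext (n : ℕ) (h : Finset.Iic n → ℕ) : ℕ → ℕ :=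
    fun k => if hk : k + 1 ∈ Finset.Iic n then h ⟨k + 1, hk⟩ else 0
  let κ (n : ℕ) : Kernel (Finset.Iic n → ℕ) ℕ :=
    Kernel.ofFunOfCountable fun h => nextLetter θ (wordTrunc (ext n h) n)
  have hκ : ∀ n, IsMarkovKernel (κ n) := fun n =>
    ⟨fun h => isProbabilityMeasure_nextLetter hs _⟩
  let P : Measure (ℕ → ℕ) := Kernel.trajMeasure (X := fun _ => ℕ) (Measure.dirac 0) κ
  have hP : IsProbabilityMeasure P := by infer_instance
  let sh : (ℕ → ℕ) → ℕ → ℕ := fun x k => x (k + 1)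
  have hsh : Measurable sh := by fun_prop
  have hext : ∀ (n : ℕ) (x : ℕ → ℕ),
      wordTrunc (ext n (Preorder.frestrictLe n x)) n = wordTrunc (sh x) n := by
    intro n x
    rw [wordTrunc_eq_iff]
    intro k hk
    simp only [ext, sh, Finset.mem_Iic, Preorder.frestrictLe_apply]
    rw [dif_pos (by omega)]
  refine ⟨P.map sh, Measure.isProbabilityMeasure_map hsh.aemeasurable, fun x => ?_⟩
  rw [Measure.map_apply hsh (measurableSet_wordCylinder x)]
  induction x using List.reverseRecOn with
  | nil => simp [h1]
  | append_singleton x i ih =>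
    set n := x.length with hn
    let U : Set (Finset.Iic n → ℕ) := {h | wordTrunc (ext n h) n = x}
    have hU : MeasurableSet U := MeasurableSet.of_discrete
    have hpre : sh ⁻¹' wordCylinder (x ++ [i]) =
        (fun y : ℕ → ℕ => (Preorder.frestrictLe (π := fun _ => ℕ) n y, y (n + 1))) ⁻¹'
          (U ×ˢ {i}) := by
      ext y
      simp only [Set.mem_preimage, mem_wordCylinder_concat, Set.mem_prod, Set.mem_singleton_iff,
        U, Set.mem_ofPred_eq, hext]
      rfl
    have hpre' : sh ⁻¹' wordCylinder x = Preorder.frestrictLe (π := fun _ => ℕ) n ⁻¹' U := by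
      ext y
      simp only [Set.mem_preimage, U, Set.mem_ofPred_eq, hext, mem_wordCylinder]
      rfl
    have hmap := Kernel.map_frestrictLe_trajMeasure_compProd_eq_map_trajMeasure
      (X := fun _ => ℕ) (μ₀ := Measure.dirac 0) (κ := κ) (a := n)
    rw [hpre, ← Measure.map_apply (by fun_prop) (hU.prod (measurableSet_singleton i))]
    change Measure.map _ (Kernel.trajMeasure (X := fun _ => ℕ) (Measure.dirac 0) κ) _ = _
    rw [← hmap, Measure.compProd_apply_prod hU (measurableSet_singleton i)]
    have hc : ∀ h ∈ U, κ n h {i} = nextLetter θ x {i} := by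
      intro h hh
      change nextLetter θ (wordTrunc (ext n h) n) {i} = _
      rw [show wordTrunc (ext n h) n = x from hh]
    rw [setLIntegral_congr_fun hU hc, setLIntegral_const, Measure.map_apply (by fun_prop) hU]
    change _ * P _ = _
    rw [← hpre', ih, mul_comm, mul_nextLetter_singleton hs (hfin x)]

end Words

/-! ### Measurability and composition of subtrees. -/

namespace MarkedTree

theorem eq_of_verts_of_mark {s t : MarkedTree} (hv : s.verts = t.verts) (hm : s.mark = t.mark) :
    s = t := by
  cases s
  cases t
  cases hv
  cases hm
  rfl

theorem measurable_coords : Measurable coords := by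
  rw [measurable_iff_comap_le, ← measurableSpace_eq_comap]

theorem measurableSet_mem_verts (x : List ℕ) : MeasurableSet {t : MarkedTree | x ∈ t.verts} := by
  have : {t : MarkedTree | x ∈ t.verts} = (fun t => (t.coords x).1) ⁻¹' {true} := by
    ext t
    simp [coords]
  rw [this]
  exact (measurable_fst.comp ((measurable_pi_apply x).comp measurable_coords))
    (measurableSet_singleton _)

theorem measurable_mark (x : List ℕ) : Measurable fun t : MarkedTree => t.mark x :=
  measurable_snd.comp ((measurable_pi_apply x).comp measurable_coords)

theorem measurable_of_verts_of_mark {α : Type*} [MeasurableSpace α] {f : α → MarkedTree}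
    (hv : ∀ x, MeasurableSet {a | x ∈ (f a).verts}) (hm : ∀ x, Measurable fun a => (f a).mark x) :
    Measurable f := by
  have hc : Measurable fun a => (f a).coords := by
    refine measurable_pi_lambda _ fun x => Measurable.prodMk ?_ (hm x)
    refine measurable_to_bool ?_
    convert hv x using 1
    ext a
    simp
  have h := measurableSpace_eq_comap
  rw [measurable_iff_comap_le]
  calc MeasurableSpace.comap f inferInstance
      = MeasurableSpace.comap f (MeasurableSpace.comap coords inferInstance) := by rw [← h]
    _ = MeasurableSpace.comap (fun a => (f a).coords) inferInstance := MeasurableSpace.comap_comp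
    _ ≤ _ := hc.comap_le

theorem mem_of_append_mem {t : MarkedTree} {x y : List ℕ} (h : x ++ y ∈ t.verts) :
    x ∈ t.verts := by
  induction y using List.reverseRecOn with
  | nil => simpa using h
  | append_singleton y i ih =>
    rw [← List.append_assoc] at h
    exact ih (t.parent_mem _ _ h)

theorem mem_subtree {t : MarkedTree} {x : List ℕ} (hx : x ∈ t.verts) {u : List ℕ} :
    u ∈ (t.subtree x).verts ↔ x ++ u ∈ t.verts := by
  rw [subtree, dif_pos hx]
  rfl

theorem mark_subtree {t : MarkedTree} {x : List ℕ} (hx : x ∈ t.verts) (u : List ℕ) :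
    (t.subtree x).mark u = t.mark (x ++ u) := by
  rw [subtree, dif_pos hx]

theorem subtree_of_notMem {t : MarkedTree} {x : List ℕ} (hx : x ∉ t.verts) : t.subtree x = t := by
  rw [subtree, dif_neg hx]

@[simp] theorem subtree_nil (t : MarkedTree) : t.subtree [] = t :=
  eq_of_verts_of_mark (by ext u; simp [mem_subtree t.root_mem])
    (by ext u; simp [mark_subtree t.root_mem])

theorem subtree_subtree {t : MarkedTree} {x y : List ℕ} (h : x ++ y ∈ t.verts) :
    (t.subtree x).subtree y = t.subtree (x ++ y) := by
  have hx := mem_of_append_mem h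
  have hy : y ∈ (t.subtree x).verts := (mem_subtree hx).2 h
  exact eq_of_verts_of_mark
    (by ext u; rw [mem_subtree hy, mem_subtree hx, mem_subtree h, List.append_assoc])
    (by ext u; rw [mark_subtree hy, mark_subtree hx, mark_subtree h, List.append_assoc])

theorem measurable_subtree (x : List ℕ) : Measurable fun t : MarkedTree => t.subtree x := by
  classical
  have hx := measurableSet_mem_verts x
  refine measurable_of_verts_of_mark (fun u => ?_) fun u => ?_
  · have : {t : MarkedTree | u ∈ (t.subtree x).verts} =
        {t | x ∈ t.verts}.ite {t | x ++ u ∈ t.verts} {t | u ∈ t.verts} := by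
      ext t
      by_cases h : x ∈ t.verts
      · simp [Set.ite, h, mem_subtree h]
      · simp [Set.ite, h, subtree_of_notMem h]
    rw [this]
    exact hx.ite (measurableSet_mem_verts _) (measurableSet_mem_verts _)
  · have : (fun t : MarkedTree => (t.subtree x).mark u) =
        fun t => if t ∈ {t : MarkedTree | x ∈ t.verts} then t.mark (x ++ u) else t.mark u := by
      ext t
      by_cases h : x ∈ t.verts
      · simp [h, mark_subtree h]
      · simp [h, subtree_of_notMem h]
    rw [this]
    exact Measurable.ite hx (measurable_mark _) (measurable_mark _)

theorem mem_children_iff {t : MarkedTree} {x : List ℕ} (hx : x ∈ t.verts) {i : ℕ} :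
    x ++ [i] ∈ t.verts ↔ i < t.numChildren x := by
  obtain ⟨k, -, h⟩ := t.children x hx
  have : t.numChildren x = k := by
    simp only [numChildren, h]
    exact Set.ncard_Iio_nat k
  rw [h, this]

theorem singleton_mem_iff {t : MarkedTree} {i : ℕ} : [i] ∈ t.verts ↔ i < t.numChildren [] :=
  mem_children_iff t.root_mem

end MarkedTree

/-! ### Branching property, zero-one law and mean growth of Galton-Watson trees. -/

namespace GaltonWatson

open ProbabilityTheory MarkedTree

theorem nil_prefix_concat_cons {y u : List ℕ} {i j : ℕ} :
    (y ++ [i]) <+: (j :: u) ↔ (y = [] ∧ i = j) ∨ ∃ y', y = j :: y' ∧ (y' ++ [i]) <+: u := by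
  cases y with
  | nil => simp
  | cons a y => simp [List.cons_prefix_cons, eq_comm]

theorem cons_mem_tree {ω : List ℕ → ℕ × ℝ≥0} {i : ℕ} {u : List ℕ} :
    i :: u ∈ (tree ω).verts ↔ i < max 1 (ω []).1 ∧ u ∈ (tree fun x => ω (i :: x)).verts := by
  change (∀ y j, _ → _) ↔ _ ∧ ∀ y j, _ → _
  simp only [nil_prefix_concat_cons]
  constructor
  · intro h
    exact ⟨h [] i (Or.inl ⟨rfl, rfl⟩), fun y j hy => h (i :: y) j (Or.inr ⟨y, rfl, hy⟩)⟩
  · rintro ⟨h1, h2⟩ y j (⟨rfl, rfl⟩ | ⟨y, rfl, hy⟩)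
    · exact h1
    · exact h2 y j hy

theorem singleton_mem_tree {ω : List ℕ → ℕ × ℝ≥0} {i : ℕ} :
    [i] ∈ (tree ω).verts ↔ i < max 1 (ω []).1 := by
  rw [cons_mem_tree]
  exact and_iff_left (root_mem _)

open Classical in
theorem mark_tree (ω : List ℕ → ℕ × ℝ≥0) (x : List ℕ) :
    (tree ω).mark x = if x ∈ (tree ω).verts then (ω x).2 else 0 := rfl

/-- The branching property before laws are taken: the labels above distinct children are disjoint
families, hence independent copies under the product measure. -/
theorem subtree_tree {ω : List ℕ → ℕ × ℝ≥0} {i : ℕ} (hi : i < max 1 (ω []).1) :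
    (tree ω).subtree [i] = tree fun x => ω (i :: x) := by
  have h := singleton_mem_tree.2 hi
  refine eq_of_verts_of_mark ?_ ?_
  · ext u
    rw [mem_subtree h, List.singleton_append, cons_mem_tree, and_iff_right hi]
  · funext u
    have hu := cons_mem_tree (ω := ω) (i := i) (u := u)
    rw [and_iff_right hi] at hu
    rw [mark_subtree h, List.singleton_append, mark_tree, mark_tree]
    classical exact if_congr hu rfl rfl

section Product

variable {X : Type*} [MeasurableSpace X] (ρ : Measure X) [IsProbabilityMeasure ρ]

theorem indep_cylinderEvents {ι : Type*} {S T : Set ι} (h : Disjoint S T) :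
    Indep (cylinderEvents (X := fun _ : ι => X) S) (cylinderEvents T)
      (Measure.infinitePi fun _ : ι => ρ) :=
  indep_iSup_of_disjoint (fun i => (measurable_pi_apply i).comap_le)
    (iIndepFun_infinitePi (P := fun _ : ι => ρ) (X := fun _ x => x) fun _ => measurable_id) h

theorem map_cons_infinitePi (i : ℕ) :
    (Measure.infinitePi fun _ : List ℕ => ρ).map (fun ω x => ω (i :: x)) =
      Measure.infinitePi fun _ : List ℕ => ρ :=
  Measure.map_infinitePi_infinitePi_of_inj (P := fun _ : List ℕ => ρ) (f := fun x => i :: x)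
    fun x y h => by simpa using h

theorem measurable_cons_cylinderEvents (i : ℕ) :
    Measurable[cylinderEvents (X := fun _ : List ℕ => X) (Set.range fun x => i :: x)]
      fun (ω : List ℕ → X) (x : List ℕ) => ω (i :: x) := by
  refine @measurable_pi_lambda _ _ _ (_) _ _ fun x => ?_
  exact measurable_cylinderEvent_apply (Set.mem_range_self x)

theorem measurable_nil_cylinderEvents :
    Measurable[cylinderEvents (X := fun _ : List ℕ => X) {[]}] fun ω : List ℕ → X => ω [] :=
  measurable_cylinderEvent_apply (Set.mem_singleton _)

theorem infinitePi_nil_inter_cons {U : Set X} (hU : MeasurableSet U) {V : Set (List ℕ → X)}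
    (hV : MeasurableSet V) (i : ℕ) :
    Measure.infinitePi (fun _ : List ℕ => ρ) {ω | ω [] ∈ U ∧ (fun x => ω (i :: x)) ∈ V} =
      ρ U * Measure.infinitePi (fun _ : List ℕ => ρ) V := by
  have h := (Indep_iff _ _ _).1 (indep_cylinderEvents ρ (S := {[]})
    (T := Set.range fun x => i :: x) (by simp))
    _ _ (measurable_nil_cylinderEvents hU) (measurable_cons_cylinderEvents i hV)
  have h1 : Measure.infinitePi (fun _ : List ℕ => ρ) ((fun ω => ω []) ⁻¹' U) = ρ U := by
    rw [← Measure.map_apply (measurable_pi_apply _) hU, Measure.infinitePi_map_eval]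
  have h2 : Measure.infinitePi (fun _ : List ℕ => ρ) ((fun ω x => ω (i :: x)) ⁻¹' V) =
      Measure.infinitePi (fun _ : List ℕ => ρ) V := by
    rw [← Measure.map_apply (by fun_prop) hV, map_cons_infinitePi]
  rw [h1, h2] at h
  exact h

theorem infinitePi_nil_inter_cons_inter_cons {U : Set X} (hU : MeasurableSet U)
    {V W : Set (List ℕ → X)} (hV : MeasurableSet V) (hW : MeasurableSet W) {i j : ℕ}
    (hij : i ≠ j) :
    Measure.infinitePi (fun _ : List ℕ => ρ)
        {ω | (ω [] ∈ U ∧ (fun x => ω (i :: x)) ∈ V) ∧ (fun x => ω (j :: x)) ∈ W} =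
      ρ U * Measure.infinitePi (fun _ : List ℕ => ρ) V *
        Measure.infinitePi (fun _ : List ℕ => ρ) W := by
  have hS : MeasurableSet[cylinderEvents (X := fun _ : List ℕ => X)
      ({[]} ∪ Set.range fun x => i :: x)] {ω | ω [] ∈ U ∧ (fun x => ω (i :: x)) ∈ V} := by
    refine MeasurableSet.inter ?_ ?_
    · exact cylinderEvents_mono Set.subset_union_left _ (measurable_nil_cylinderEvents hU)
    · exact cylinderEvents_mono Set.subset_union_right _ (measurable_cons_cylinderEvents i hV)
  have h := (Indep_iff _ _ _).1 (indep_cylinderEvents ρ (S := {[]} ∪ Set.range fun x => i :: x)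
    (T := Set.range fun x => j :: x) (by
      rw [Set.disjoint_left]
      rintro x (rfl | ⟨u, rfl⟩) ⟨v, hv⟩
      · simp at hv
      · simp only [List.cons.injEq] at hv
        exact hij hv.1.symm))
    _ _ hS (measurable_cons_cylinderEvents j hW)
  have h2 : Measure.infinitePi (fun _ : List ℕ => ρ) ((fun ω x => ω (j :: x)) ⁻¹' W) =
      Measure.infinitePi (fun _ : List ℕ => ρ) W := by
    rw [← Measure.map_apply (by fun_prop) hW, map_cons_infinitePi]
  rw [infinitePi_nil_inter_cons ρ hU hV, h2] at h
  exact h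

end Product

variable (p : PMF ℕ) (η : Measure ℝ≥0) [IsProbabilityMeasure η]

theorem prod_fst_preimage (s : Set ℕ) : p.toMeasure.prod η {z | z.1 ∈ s} = p.toMeasure s := by
  have : {z : ℕ × ℝ≥0 | z.1 ∈ s} = s ×ˢ Set.univ := by ext; simp
  rw [this, Measure.prod_prod, measure_univ, mul_one]

/-- A property which is inherited by the subtrees of the children of the root has probability
`0` or `1`. -/
theorem law_eq_zero_or_one (hp0 : p 0 = 0) (hp1 : p 1 < 1) {A : Set MarkedTree}
    (hA : MeasurableSet A)
    (h : ∀ᵐ t ∂law p η, t ∈ A → ∀ i, [i] ∈ t.verts → t.subtree [i] ∈ A) :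
    law p η A = 0 ∨ law p η A = 1 := by
  set P := Measure.infinitePi fun _ : List ℕ => p.toMeasure.prod η with hP
  have hprob := isProbabilityMeasure_law p η
  have hV : MeasurableSet (tree ⁻¹' A) := measurable_tree hA
  have hq : law p η A = P (tree ⁻¹' A) := Measure.map_apply measurable_tree hA
  set q := law p η A with hqdef
  set U : Set (ℕ × ℝ≥0) := {z | z.1 ∈ Set.Iic 1} with hU
  have hUm : MeasurableSet U := measurable_fst (MeasurableSet.of_discrete (s := Set.Iic 1))
  have ha : p.toMeasure.prod η U = p 1 := by
    rw [hU, prod_fst_preimage, PMF.toMeasure_apply (hs := MeasurableSet.of_discrete),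
      tsum_eq_single 1]
    · simp
    · intro k hk
      rcases Nat.lt_or_gt_of_ne hk with h | h
      · obtain rfl : k = 0 := by omega
        simp [hp0]
      · exact Set.indicator_of_notMem (by simpa using h) _
  -- As `p 0 = 0`, the root has one child with probability `p 1` and at least two otherwise. Keeping
  -- only children `0` and `1`, whose subtrees must also lie in `A`, is enough.
  have hle : q ≤ p 1 * q + (1 - p 1) * q * q := by
    rw [hq]
    have h' : ∀ᵐ ω ∂P, tree ω ∈ A → ∀ i, [i] ∈ (tree ω).verts → (tree ω).subtree [i] ∈ A :=
      ae_of_ae_map measurable_tree.aemeasurable h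
    calc P (tree ⁻¹' A)
        ≤ P ({ω | ω [] ∈ U ∧ (fun x => ω (0 :: x)) ∈ tree ⁻¹' A} ∪
            {ω | (ω [] ∈ Uᶜ ∧ (fun x => ω (0 :: x)) ∈ tree ⁻¹' A) ∧
              (fun x => ω (1 :: x)) ∈ tree ⁻¹' A}) := by
          refine measure_mono_ae ?_
          filter_upwards [h'] with ω hω hωA
          have h0 : 0 < max 1 (ω []).1 := by simp
          have hc := fun i hi => hω hωA i (singleton_mem_tree.2 hi)
          have hc0 := hc 0 h0
          rw [subtree_tree h0] at hc0
          by_cases hν : ω [] ∈ U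
          · exact Or.inl ⟨hν, hc0⟩
          · have h1 : 1 < max 1 (ω []).1 := by
              simp only [hU, Set.mem_ofPred_eq, Set.mem_Iic, not_le] at hν
              exact lt_max_of_lt_right hν
            have hc1 := hc 1 h1
            rw [subtree_tree h1] at hc1
            exact Or.inr ⟨⟨hν, hc0⟩, hc1⟩
      _ ≤ _ := measure_union_le _ _
      _ = _ := by
          rw [infinitePi_nil_inter_cons _ hUm hV,
            infinitePi_nil_inter_cons_inter_cons _ hUm.compl hV hV zero_ne_one,
            prob_compl_eq_one_sub hUm, ha]
  have hq1 : q ≤ 1 := prob_le_one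
  have hqf : q ≠ ∞ := ne_top_of_le_ne_top ENNReal.one_ne_top hq1
  have hpf : p 1 ≠ ∞ := PMF.apply_ne_top p 1
  clear_value q
  lift q to ℝ≥0 using hqf
  generalize p 1 = a at *
  lift a to ℝ≥0 using hpf
  rw [← ENNReal.coe_one, ← ENNReal.coe_sub] at hle
  norm_cast at hle hp1 hq1 ⊢
  rw [← NNReal.coe_le_coe] at hle hq1
  push_cast [NNReal.coe_sub hp1.le] at hle
  rw [← NNReal.coe_lt_coe] at hp1
  have hq0 := q.2
  push_cast at *
  -- Since `p 1 < 1`, this forces `q * (1 - q) = 0`.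
  have h3 : (1 - (a : ℝ)) * (q * (1 - q)) ≤ 0 := by linarith
  have h4 : (q : ℝ) * (1 - q) ≤ 0 := by
    by_contra hcon
    push Not at hcon
    nlinarith
  have h5 : (q : ℝ) * (1 - q) = 0 := le_antisymm h4 (mul_nonneg hq0 (by linarith))
  rcases mul_eq_zero.1 h5 with h | h
  · left; exact_mod_cast h
  · right
    have : (q : ℝ) = 1 := by linarith
    exact_mod_cast this

theorem law_cons_mem (i : ℕ) (u : List ℕ) :
    law p η {t | i :: u ∈ t.verts} =
      p.toMeasure {k | i < max 1 k} * law p η {t | u ∈ t.verts} := by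
  rw [law, Measure.map_apply measurable_tree (measurableSet_mem_verts _),
    Measure.map_apply measurable_tree (measurableSet_mem_verts _), ← prod_fst_preimage p η,
    ← infinitePi_nil_inter_cons _ (U := {z : ℕ × ℝ≥0 | z.1 ∈ {k | i < max 1 k}})
      (measurable_fst (MeasurableSet.of_discrete (s := {k : ℕ | i < max 1 k})))
      (measurable_tree (measurableSet_mem_verts _)) i]
  congr 1
  ext ω
  exact cons_mem_tree

/-- The mean number of vertices at height `n`. -/
theorem tsum_law_mem (n : ℕ) :
    ∑' x : Fin n → ℕ, law p η {t | List.ofFn x ∈ t.verts} =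
      (∑' i, p.toMeasure {k | i < max 1 k}) ^ n := by
  have hprob := isProbabilityMeasure_law p η
  induction n with
  | zero => simp [root_mem]
  | succ n ih =>
    rw [← (Fin.consEquiv fun _ => ℕ).tsum_eq, ENNReal.tsum_prod', pow_succ', ← ih,
      ← ENNReal.tsum_mul_right]
    refine tsum_congr fun i => ?_
    rw [← ENNReal.tsum_mul_left]
    refine tsum_congr fun x => ?_
    rw [← law_cons_mem]
    simp [Fin.consEquiv]

/-- By the tail formula the sum is the mean of `max 1 k`, at most one plus the mean of `p`. -/
theorem tsum_max_one_ne_top (hm : ∑' k : ℕ, (k : ℝ≥0∞) * p k < ∞) :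
    ∑' i, p.toMeasure {k | i < max 1 k} ≠ ∞ := by
  have h : ∀ i : ℕ, p.toMeasure {k | i < max 1 k} =
      ∑' k, p k * (if i < max 1 k then 1 else 0) := fun i => by
    rw [PMF.toMeasure_apply (hs := MeasurableSet.of_discrete)]
    refine tsum_congr fun k => ?_
    simp [Set.indicator_apply]
  simp_rw [h]
  rw [ENNReal.tsum_comm]
  simp_rw [ENNReal.tsum_mul_left]
  have h2 : ∀ k : ℕ, ∑' i : ℕ, (if i < max 1 k then (1 : ℝ≥0∞) else 0) = (max 1 k : ℕ) := by
    intro k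
    rw [tsum_eq_sum (s := Finset.range (max 1 k)) (fun i hi => if_neg (by simpa using hi)),
      Finset.sum_congr rfl (fun i hi => if_pos (Finset.mem_range.1 hi))]
    simp
  simp_rw [h2]
  have h3 : ∑' k : ℕ, p k * ((max 1 k : ℕ) : ℝ≥0∞) ≤ ∑' k : ℕ, (p k + (k : ℝ≥0∞) * p k) := by
    refine ENNReal.tsum_le_tsum fun k => ?_
    calc p k * ((max 1 k : ℕ) : ℝ≥0∞) ≤ p k * ((1 + k : ℕ) : ℝ≥0∞) := by
          gcongr
          omega
      _ = _ := by push_cast; ring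
  refine ne_top_of_le_ne_top ?_ h3
  rw [ENNReal.tsum_add, p.tsum_coe]
  exact ENNReal.add_ne_top.2 ⟨ENNReal.one_ne_top, hm.ne⟩

theorem one_le_tsum_max_one : 1 ≤ ∑' i, p.toMeasure {k | i < max 1 k} := by
  have h : p.toMeasure {k | 0 < max 1 k} = 1 := by
    have : {k : ℕ | 0 < max 1 k} = Set.univ := by ext; simp
    rw [this, measure_univ]
  exact h.symm.le.trans (ENNReal.le_tsum 0)

end GaltonWatson

/-! ### Rays drawn according to a flow rule. -/

section FlowMeasure

open ProbabilityTheory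

/-- Extension by `0` makes a flow on `t` a flow on the tree of all words, the form used by
`exists_measure_wordCylinder`. -/
theorem MarkedTree.IsFlow.tsum_ofReal {t : MarkedTree} {θ : List ℕ → ℝ} (h : t.IsFlow θ)
    (x : List ℕ) : ENNReal.ofReal (θ x) = ∑' i, ENNReal.ofReal (θ (x ++ [i])) := by
  by_cases hx : x ∈ t.verts
  · rw [tsum_eq_sum (s := Finset.range (t.numChildren x)), h.sum_children x hx,
      ENNReal.ofReal_sum_of_nonneg]
    · intro i hi
      exact (h.mem_Icc _ ((mem_children_iff hx).2 (Finset.mem_range.1 hi))).1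
    · intro i hi
      rw [h.off _ fun hc => hi (Finset.mem_range.2 ((mem_children_iff hx).1 hc)),
        ENNReal.ofReal_zero]
  · have hc : ∀ i, θ (x ++ [i]) = 0 := fun i => h.off _ fun hc => hx (t.parent_mem _ _ hc)
    simp [h.off x hx, hc]

namespace FlowRule

variable (Θ : FlowRule)

theorem exists_rayLaw {t : MarkedTree} (ht : t ∈ Θ.dom) :
    ∃ m : Measure (ℕ → ℕ), IsProbabilityMeasure m ∧
      ∀ x, m (wordCylinder x) = ENNReal.ofReal (Θ.flow t x) :=
  exists_measure_wordCylinder (by simp [(Θ.isFlow t ht).root]) (Θ.isFlow t ht).tsum_ofReal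

open Classical in
/-- The law on infinite words of a ray drawn according to the flow rule (an arbitrary probability
measure outside the domain of the rule). -/
noncomputable def rayLaw (t : MarkedTree) : Measure (ℕ → ℕ) :=
  if ht : t ∈ Θ.dom then (Θ.exists_rayLaw ht).choose else Measure.dirac 0

instance (t : MarkedTree) : IsProbabilityMeasure (Θ.rayLaw t) := by
  unfold rayLaw
  split_ifs with ht
  · exact (Θ.exists_rayLaw ht).choose_spec.1
  · infer_instance

variable {Θ} {t : MarkedTree} {x : List ℕ} {i : ℕ}

theorem rayLaw_wordCylinder (ht : t ∈ Θ.dom) (x : List ℕ) :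
    Θ.rayLaw t (wordCylinder x) = ENNReal.ofReal (Θ.flow t x) := by
  rw [rayLaw, dif_pos ht]
  exact (Θ.exists_rayLaw ht).choose_spec.2 x

/-- Although obtained by choice, the law is prescribed on the cylinders, a generating π-system on
which it depends measurably on the tree. -/
theorem measurable_rayLaw : Measurable Θ.rayLaw := by
  refine Measurable.measure_of_isPiSystem_of_isProbabilityMeasure generateFrom_wordCylinder
    isPiSystem_wordCylinder ?_
  rintro _ ⟨x, rfl⟩
  refine measurable_of_restrict_of_restrict_compl Θ.measurableSet_dom ?_ ?_
  · have : Θ.dom.domRestrict (fun t => Θ.rayLaw t (wordCylinder x)) =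
        fun t : Θ.dom => ENNReal.ofReal (Θ.flow t x) := by
      ext t
      exact rayLaw_wordCylinder t.2 x
    rw [this]
    exact (Θ.measurable_flow x).ennreal_ofReal
  · have : (Θ.dom)ᶜ.domRestrict (fun t => Θ.rayLaw t (wordCylinder x)) =
        fun _ => Measure.dirac (0 : ℕ → ℕ) (wordCylinder x) := by
      ext t
      rw [Set.domRestrict_apply, rayLaw, dif_neg t.2]
    rw [this]
    exact measurable_const

variable (Θ) in
/-- The kernel which draws a ray according to the flow rule. -/
noncomputable def rayKernel : Kernel MarkedTree (ℕ → ℕ) := ⟨Θ.rayLaw, measurable_rayLaw⟩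

theorem rayKernel_apply (t : MarkedTree) : Θ.rayKernel t = Θ.rayLaw t := rfl

instance : IsMarkovKernel Θ.rayKernel :=
  ⟨fun t => inferInstanceAs (IsProbabilityMeasure (Θ.rayLaw t))⟩

theorem rayLaw_wordCylinder_pos (ht : t ∈ Θ.dom) (hx : x ∈ t.verts) :
    0 < Θ.rayLaw t (wordCylinder x) := by
  rw [rayLaw_wordCylinder ht]
  exact ENNReal.ofReal_pos.2 (Θ.pos t ht x hx)

theorem rayLaw_wordCylinder_of_notMem (ht : t ∈ Θ.dom) (hx : x ∉ t.verts) :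
    Θ.rayLaw t (wordCylinder x) = 0 := by
  rw [rayLaw_wordCylinder ht, (Θ.isFlow t ht).off x hx, ENNReal.ofReal_zero]

theorem flow_append (ht : t ∈ Θ.dom) (hx : x ∈ t.verts) (y : List ℕ) :
    Θ.flow t (x ++ y) = Θ.flow t x * Θ.flow (t.subtree x) y := by
  have hpos := Θ.pos t ht x hx
  by_cases hy : y ∈ (t.subtree x).verts
  · rw [Θ.consistent t ht x hx y hy]
    field_simp
  · rw [(Θ.isFlow _ (Θ.subtree_mem t ht x hx)).off y hy, mul_zero]
    exact (Θ.isFlow t ht).off _ fun h => hy ((MarkedTree.mem_subtree hx).2 h)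

/-- Given that the ray goes through `x`, its part above `x` is a ray of the subtree at `x` drawn
according to the flow rule. -/
theorem rayLaw_wordCylinder_inter (ht : t ∈ Θ.dom) (hx : x ∈ t.verts) {B : Set (ℕ → ℕ)}
    (hB : MeasurableSet B) :
    Θ.rayLaw t (wordCylinder x ∩ {ξ | (fun k => ξ (x.length + k)) ∈ B}) =
      ENNReal.ofReal (Θ.flow t x) * Θ.rayLaw (t.subtree x) B := by
  have hsh : Measurable fun (ξ : ℕ → ℕ) k => ξ (x.length + k) := by fun_prop
  have key : ((Θ.rayLaw t).restrict (wordCylinder x)).map (fun ξ k => ξ (x.length + k)) =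
      ENNReal.ofReal (Θ.flow t x) • Θ.rayLaw (t.subtree x) := by
    refine measure_ext_of_wordCylinder fun y => ?_
    rw [Measure.map_apply hsh (measurableSet_wordCylinder y),
      Measure.restrict_apply (hsh (measurableSet_wordCylinder y)), Measure.smul_apply,
      rayLaw_wordCylinder (Θ.subtree_mem t ht x hx), smul_eq_mul,
      ← ENNReal.ofReal_mul (Θ.pos t ht x hx).le, ← flow_append ht hx, ← rayLaw_wordCylinder ht]
    congr 1
    ext ξ
    rw [mem_wordCylinder_append, and_comm]
    rfl
  have h := congrArg (fun m => m B) key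
  rw [Measure.map_apply hsh hB, Measure.restrict_apply (hsh hB), Set.inter_comm] at h
  exact h

theorem ae_mem_boundary (ht : t ∈ Θ.dom) : ∀ᵐ ξ ∂Θ.rayLaw t, ξ ∈ t.boundary := by
  have h : ∀ᵐ ξ ∂Θ.rayLaw t, ∀ x : List ℕ, x ∉ t.verts → ξ ∉ wordCylinder x := by
    rw [ae_all_iff]
    intro x
    by_cases hx : x ∈ t.verts
    · exact Eventually.of_forall fun ξ h => absurd hx h
    · filter_upwards [measure_eq_zero_iff_ae_notMem.1 (rayLaw_wordCylinder_of_notMem ht hx)]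
        with ξ hξ _ using hξ
  filter_upwards [h] with ξ hξ n
  by_contra hn
  exact hξ _ hn (mem_wordCylinder_wordTrunc.2 rfl)

theorem lintegral_rayLaw_head (ht : t ∈ Θ.dom) (G : ℕ → ℝ≥0∞) :
    ∫⁻ ξ, G (ξ 0) ∂Θ.rayLaw t = ∑' i, G i * ENNReal.ofReal (Θ.flow t [i]) := by
  have hm : Measurable fun ξ : ℕ → ℕ => ξ 0 := measurable_pi_apply 0
  rw [← lintegral_map (f := G) (measurable_of_countable _) hm, lintegral_countable']
  refine tsum_congr fun i => ?_
  rw [Measure.map_apply hm (measurableSet_singleton i), ← rayLaw_wordCylinder ht]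
  congr 2
  ext ξ
  simp [mem_wordCylinder, wordTrunc]

/-- This is where positivity of the flow matters: every child is charged, so an almost sure property
of the first letter holds for all children. -/
theorem ae_rayLaw_head (ht : t ∈ Θ.dom) {Q : ℕ → Prop} (h : ∀ᵐ ξ ∂Θ.rayLaw t, Q (ξ 0))
    (hi : [i] ∈ t.verts) : Q i := by
  by_contra hQ
  have : wordCylinder [i] ⊆ {ξ | ¬ Q (ξ 0)} := by
    intro ξ hξ
    have : ξ 0 = i := by simpa [mem_wordCylinder, wordTrunc] using hξ
    rwa [Set.mem_ofPred_eq, this]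
  exact (rayLaw_wordCylinder_pos ht hi).ne' (measure_mono_null this (ae_iff.1 h))

end FlowRule

/-- The tree obtained by moving along the ray to its first vertex above the root. -/
noncomputable def rayStep (z : MarkedTree × (ℕ → ℕ)) : MarkedTree := z.1.subtree [z.2 0]

/-- The shift on pairs of a tree and a ray. -/
noncomputable def rayShift (z : MarkedTree × (ℕ → ℕ)) : MarkedTree × (ℕ → ℕ) :=
  (rayStep z, fun k => z.2 (k + 1))

theorem measurable_rayStep : Measurable rayStep := by
  have h : Measurable fun q : MarkedTree × ℕ => q.1.subtree [q.2] :=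
    measurable_from_prod_countable_left fun i => MarkedTree.measurable_subtree [i]
  exact h.comp (measurable_fst.prodMk ((measurable_pi_apply 0).comp measurable_snd))

theorem measurable_rayShift : Measurable rayShift :=
  measurable_rayStep.prodMk (measurable_pi_lambda _ fun k =>
    (measurable_pi_apply (k + 1)).comp measurable_snd)

theorem iterate_rayShift {t : MarkedTree} {ξ : ℕ → ℕ} {n : ℕ} (h : wordTrunc ξ n ∈ t.verts) :
    rayShift^[n] (t, ξ) = (t.subtree (wordTrunc ξ n), fun k => ξ (n + k)) := by
  induction n with
  | zero => simp
  | succ n ih =>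
    have h' := h
    rw [wordTrunc_succ] at h'
    rw [Function.iterate_succ_apply', ih (MarkedTree.mem_of_append_mem h'), rayShift, rayStep]
    simp only [add_zero]
    rw [MarkedTree.subtree_subtree h', wordTrunc_succ]
    congr 1
    funext k
    congr 1
    omega

end FlowMeasure

/-! ### Invariant measures: preservation by the shift and harmonic functions. -/

namespace FlowRule

open ProbabilityTheory

variable {Θ : FlowRule} {μ : Measure MarkedTree} [IsProbabilityMeasure μ]

theorem IsRuleFor.ae_mem_dom {μ : Measure MarkedTree} (h : Θ.IsRuleFor μ) :
    ∀ᵐ t ∂μ, t ∈ Θ.dom := h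

/-- The first letter of the ray is `i` with probability `Θ_t(i)`, so `rayStep` realises one move of
the Markov chain. -/
theorem IsInvariant.measurePreserving_rayStep (h : Θ.IsInvariant μ) :
    MeasurePreserving rayStep (μ ⊗ₘ Θ.rayKernel) μ := by
  classical
  refine ⟨measurable_rayStep, Measure.ext fun A hA => ?_⟩
  rw [Measure.map_apply measurable_rayStep hA,
    Measure.compProd_apply (measurable_rayStep hA), ← h.2 A hA]
  refine lintegral_congr_ae ?_
  filter_upwards [h.1.ae_mem_dom] with t ht
  have hset : MeasurableSet {ξ : ℕ → ℕ | t.subtree [ξ 0] ∈ A} :=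
    (measurable_pi_apply (X := fun _ : ℕ => ℕ) 0)
      (MeasurableSet.of_discrete (s := {i : ℕ | t.subtree [i] ∈ A}))
  have h1 : Θ.rayKernel t (Prod.mk t ⁻¹' (rayStep ⁻¹' A)) =
      ∫⁻ ξ, (if t.subtree [ξ 0] ∈ A then 1 else 0) ∂Θ.rayLaw t := by
    refine (lintegral_indicator_one (μ := Θ.rayLaw t) hset).symm.trans ?_
    refine lintegral_congr fun ξ => ?_
    simp [Set.indicator_apply]
  rw [h1, lintegral_rayLaw_head ht (fun i => if t.subtree [i] ∈ A then 1 else 0),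
    tsum_eq_sum (s := Finset.range (t.numChildren []))]
  · refine Finset.sum_congr rfl fun i _ => ?_
    split_ifs <;> simp
  · intro i hi
    rw [(Θ.isFlow t ht).off [i] fun hc => hi (Finset.mem_range.2 (MarkedTree.singleton_mem_iff.1 hc))]
    simp

/-- One move preserves `μ` and reaches each child with positive probability, so a null set is
avoided by all children; then induct on the word. -/
theorem IsInvariant.ae_subtree (h : Θ.IsInvariant μ) {Q : MarkedTree → Prop}
    (hQ : ∀ᵐ t ∂μ, Q t) : ∀ᵐ t ∂μ, ∀ x ∈ t.verts, Q (t.subtree x) := by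
  have step : ∀ {Q : MarkedTree → Prop}, (∀ᵐ t ∂μ, Q t) →
      ∀ᵐ t ∂μ, ∀ i, [i] ∈ t.verts → Q (t.subtree [i]) := by
    intro Q hQ
    have h1 := h.measurePreserving_rayStep.quasiMeasurePreserving.ae hQ
    filter_upwards [Measure.ae_ae_of_ae_compProd h1, h.1.ae_mem_dom] with t ht hd i hi
    exact ae_rayLaw_head (Q := fun i => Q (t.subtree [i])) hd ht hi
  rw [ae_all_iff]
  intro x
  induction x with
  | nil => filter_upwards [hQ] with t ht _ using by simpa using ht
  | cons i u ih =>
    filter_upwards [step ih] with t ht hx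
    have hx' : [i] ++ u ∈ t.verts := hx
    have hi := MarkedTree.mem_of_append_mem hx'
    have := ht i hi ((MarkedTree.mem_subtree hi).2 hx')
    rwa [MarkedTree.subtree_subtree hx'] at this

theorem measurable_rayLaw_section {A : Set (MarkedTree × (ℕ → ℕ))} (hA : MeasurableSet A) :
    Measurable fun t => Θ.rayLaw t (Prod.mk t ⁻¹' A) :=
  Kernel.measurable_kernel_prodMk_left (κ := Θ.rayKernel) hA

/-- Markov property at time one, by splitting according to the first letter. -/
theorem rayLaw_preimage_rayShift {t : MarkedTree} (ht : t ∈ Θ.dom)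
    {A : Set (MarkedTree × (ℕ → ℕ))} (hA : MeasurableSet A) :
    Θ.rayLaw t (Prod.mk t ⁻¹' (rayShift ⁻¹' A)) =
      ∫⁻ ξ, Θ.rayLaw (t.subtree [ξ 0]) (Prod.mk (t.subtree [ξ 0]) ⁻¹' A) ∂Θ.rayLaw t := by
  have hcov : Prod.mk t ⁻¹' (rayShift ⁻¹' A) =
      ⋃ i : ℕ, wordCylinder [i] ∩
        {ξ | (fun k => ξ ([i].length + k)) ∈ Prod.mk (t.subtree [i]) ⁻¹' A} := by
    ext ξ
    simp [rayShift, rayStep, mem_wordCylinder, wordTrunc, add_comm]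
  have hmeas : ∀ i : ℕ, MeasurableSet (Prod.mk (t.subtree [i]) ⁻¹' A) :=
    fun i => measurable_prodMk_left hA
  rw [hcov, measure_iUnion]
  · rw [lintegral_rayLaw_head ht
      (fun i => Θ.rayLaw (t.subtree [i]) (Prod.mk (t.subtree [i]) ⁻¹' A))]
    refine tsum_congr fun i => ?_
    by_cases hi : [i] ∈ t.verts
    · rw [rayLaw_wordCylinder_inter ht hi (hmeas i), mul_comm]
    · rw [(Θ.isFlow t ht).off _ hi, ENNReal.ofReal_zero, mul_zero]
      exact measure_mono_null Set.inter_subset_left (rayLaw_wordCylinder_of_notMem ht hi)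
  · intro i j hij
    refine Set.disjoint_left.2 fun ξ hi hj => hij ?_
    have h1 := hi.1
    have h2 := hj.1
    simp only [mem_wordCylinder, wordTrunc] at h1 h2
    simpa using h1.symm.trans h2
  · intro i
    have hsh : Measurable fun (ξ : ℕ → ℕ) k => ξ ([i].length + k) := by fun_prop
    exact (measurableSet_wordCylinder [i]).inter (hsh (hmeas i))

theorem IsInvariant.measurePreserving_rayShift (h : Θ.IsInvariant μ) :
    MeasurePreserving rayShift (μ ⊗ₘ Θ.rayKernel) (μ ⊗ₘ Θ.rayKernel) := by
  refine ⟨measurable_rayShift, Measure.ext fun A hA => ?_⟩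
  have hg := measurable_rayLaw_section (Θ := Θ) hA
  rw [Measure.map_apply measurable_rayShift hA,
    Measure.compProd_apply (measurable_rayShift hA), Measure.compProd_apply hA]
  calc ∫⁻ t, Θ.rayKernel t (Prod.mk t ⁻¹' (rayShift ⁻¹' A)) ∂μ
      = ∫⁻ t, ∫⁻ ξ, Θ.rayLaw (rayStep (t, ξ)) (Prod.mk (rayStep (t, ξ)) ⁻¹' A)
          ∂Θ.rayKernel t ∂μ := by
        refine lintegral_congr_ae ?_
        filter_upwards [h.1.ae_mem_dom] with t ht
        exact rayLaw_preimage_rayShift ht hA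
    _ = ∫⁻ z, Θ.rayLaw (rayStep z) (Prod.mk (rayStep z) ⁻¹' A) ∂(μ ⊗ₘ Θ.rayKernel) :=
        (Measure.lintegral_compProd (hg.comp measurable_rayStep)).symm
    _ = ∫⁻ t, Θ.rayLaw t (Prod.mk t ⁻¹' A) ∂μ :=
        h.measurePreserving_rayStep.lintegral_comp hg

/-- A bounded function which is harmonic for the Markov chain of an invariant measure is constant
along the trajectories. -/
theorem IsInvariant.ae_eq_of_harmonic (h : Θ.IsInvariant μ) {g : MarkedTree → ℝ}
    (hg : Measurable g) (hb : ∀ t, ‖g t‖ ≤ 1)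
    (hh : ∀ᵐ t ∂μ, g t = ∫ ξ, g (t.subtree [ξ 0]) ∂Θ.rayLaw t) :
    ∀ᵐ t ∂μ, ∀ i, [i] ∈ t.verts → g (t.subtree [i]) = g t := by
  set P := μ ⊗ₘ Θ.rayKernel with hP
  have hs := h.measurePreserving_rayStep
  have hm1 : Measurable fun z => g (rayStep z) := hg.comp measurable_rayStep
  have hm0 : Measurable fun z : MarkedTree × (ℕ → ℕ) => g z.1 := hg.comp measurable_fst
  have hbd : ∀ {u v : MarkedTree × (ℕ → ℕ) → ℝ}, Measurable u → Measurable v →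
      (∀ z, ‖u z‖ ≤ 1) → (∀ z, ‖v z‖ ≤ 1) → Integrable (fun z => u z * v z) P := by
    intro u v hu hv hu1 hv1
    refine Integrable.of_bound (hu.mul hv).aestronglyMeasurable 1 (Eventually.of_forall fun z => ?_)
    rw [norm_mul]
    exact mul_le_one₀ (hu1 z) (norm_nonneg _) (hv1 z)
  have i11 := hbd hm1 hm1 (fun z => hb _) (fun z => hb _)
  have i10 := hbd hm1 hm0 (fun z => hb _) (fun z => hb _)
  have i00 := hbd hm0 hm0 (fun z => hb _) (fun z => hb _)
  have e11 : ∫ z, g (rayStep z) * g (rayStep z) ∂P = ∫ t, g t * g t ∂μ := by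
    have := integral_map hs.measurable.aemeasurable (μ := P) (f := fun t => g t * g t)
      (hg.mul hg).aestronglyMeasurable
    rw [hs.map_eq] at this
    exact this.symm
  have e00 : ∫ z, g z.1 * g z.1 ∂P = ∫ t, g t * g t ∂μ := by
    rw [hP, Measure.integral_compProd i00]
    simp
  have e10 : ∫ z, g (rayStep z) * g z.1 ∂P = ∫ t, g t * g t ∂μ := by
    rw [hP, Measure.integral_compProd i10]
    refine integral_congr_ae ?_
    filter_upwards [hh] with t ht
    simp only [rayStep]
    rw [integral_mul_const, rayKernel_apply, ← ht]
  have hsq : (fun z => (g (rayStep z) - g z.1) ^ 2) = fun z =>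
      (g (rayStep z) * g (rayStep z) - 2 * (g (rayStep z) * g z.1)) + g z.1 * g z.1 := by
    funext z
    ring
  have i2 : Integrable (fun z => g (rayStep z) * g (rayStep z) - 2 * (g (rayStep z) * g z.1)) P :=
    i11.sub (i10.const_mul 2)
  -- The two squares and the cross term all have integral `∫ g²`: by invariance, by the marginal on
  -- trees and by harmonicity. So the increment vanishes in `L²`.
  have hzero : ∫ z, (g (rayStep z) - g z.1) ^ 2 ∂P = 0 := by
    rw [hsq, integral_add i2 i00, integral_sub i11 (i10.const_mul 2), integral_const_mul,
      e11, e10, e00]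
    ring
  have hint : Integrable (fun z => (g (rayStep z) - g z.1) ^ 2) P := by
    rw [hsq]
    exact i2.add i00
  have hae := (integral_eq_zero_iff_of_nonneg (fun z => sq_nonneg _) hint).1 hzero
  filter_upwards [Measure.ae_ae_of_ae_compProd hae, h.1.ae_mem_dom] with t ht hd i hi
  have := ae_rayLaw_head (Q := fun i => (g (t.subtree [i]) - g t) ^ 2 = 0) hd ht hi
  have h2 := pow_eq_zero_iff (two_ne_zero) |>.1 this
  linarith

end FlowRule

/-! ### Equivalence with the Galton-Watson law, ergodicity, and decay of the mass. -/

namespace FlowRule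

open ProbabilityTheory GaltonWatson

variable {Θ : FlowRule} {μ : Measure MarkedTree} [IsProbabilityMeasure μ]
  {p : PMF ℕ} {η : Measure ℝ≥0} [IsProbabilityMeasure η]

/-- An invariant measure which is absolutely continuous with respect to the law of the
Galton-Watson tree is equivalent to it. -/
theorem IsInvariant.law_absolutelyContinuous (h : Θ.IsInvariant μ) (hp0 : p 0 = 0) (hp1 : p 1 < 1)
    (hμ : μ ≪ law p η) : law p η ≪ μ := by
  have hprob := isProbabilityMeasure_law p η
  have hm : Measurable (μ.rnDeriv (law p η)) := Measure.measurable_rnDeriv _ _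
  have hd := Measure.withDensity_rnDeriv_eq μ (law p η) hμ
  have h0 : ∀ᵐ t ∂μ, μ.rnDeriv (law p η) t ≠ 0 := by
    have : ∀ᵐ t ∂(law p η).withDensity (μ.rnDeriv (law p η)), μ.rnDeriv (law p η) t ≠ 0 :=
      (ae_withDensity_iff hm).2 (Eventually.of_forall fun t ht => ht)
    rwa [hd] at this
  have hA : MeasurableSet {t | μ.rnDeriv (law p η) t ≠ 0} :=
    (hm (measurableSet_singleton 0)).compl
  have hinh : ∀ᵐ t ∂law p η, t ∈ {t | μ.rnDeriv (law p η) t ≠ 0} → ∀ i, [i] ∈ t.verts →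
      t.subtree [i] ∈ {t | μ.rnDeriv (law p η) t ≠ 0} := by
    have := h.ae_subtree h0
    rw [← congrArg ae hd, ae_withDensity_iff hm] at this
    filter_upwards [this] with t ht hne i hi using ht hne [i] hi
  -- Positivity of the density is inherited by children. Probability `0` is excluded because the
  -- density is positive `μ`-almost everywhere.
  rcases law_eq_zero_or_one p η hp0 hp1 hA hinh with h1 | h1
  · have h2 : ∀ᵐ t ∂μ, ¬ μ.rnDeriv (law p η) t ≠ 0 :=
      hμ.ae_le (measure_eq_zero_iff_ae_notMem.1 h1)
    obtain ⟨t, ht1, ht2⟩ := (h0.and h2).exists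
    exact absurd ht1 ht2
  · have h2 : ∀ᵐ t ∂law p η, μ.rnDeriv (law p η) t ≠ 0 := (prob_compl_eq_zero_iff hA).2 h1
    have h3 := withDensity_absolutelyContinuous' hm.aemeasurable h2
    rwa [hd] at h3

/-- The shift on the pairs of a tree and a ray is ergodic. -/
theorem IsInvariant.ergodic_rayShift (h : Θ.IsInvariant μ) (hp0 : p 0 = 0) (hp1 : p 1 < 1)
    (hμ : μ ≪ law p η) : Ergodic rayShift (μ ⊗ₘ Θ.rayKernel) := by
  refine ⟨h.measurePreserving_rayShift, ⟨fun A hA hinv => ?_⟩⟩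
  have hprob := isProbabilityMeasure_law p η
  -- The conditional probability of `A` given the tree; invariance of `A` and the Markov property
  -- make it harmonic.
  set g : MarkedTree → ℝ≥0∞ := fun t => Θ.rayLaw t (Prod.mk t ⁻¹' A) with hg
  have hgm : Measurable g := measurable_rayLaw_section hA
  have hg1 : ∀ t, g t ≤ 1 := fun t => prob_le_one
  have hgr : ∀ᵐ t ∂μ, ∀ i, [i] ∈ t.verts → (g (t.subtree [i])).toReal = (g t).toReal := by
    refine h.ae_eq_of_harmonic (g := fun t => (g t).toReal) hgm.ennreal_toReal (fun t => ?_) ?_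
    · rw [Real.norm_of_nonneg ENNReal.toReal_nonneg]
      exact ENNReal.toReal_le_of_le_ofReal zero_le_one (by simpa using hg1 t)
    · filter_upwards [h.1.ae_mem_dom] with t ht
      have h1 := rayLaw_preimage_rayShift ht hA
      rw [hinv] at h1
      rw [integral_toReal]
      · exact congrArg ENNReal.toReal h1
      · exact ((measurable_of_countable fun i : ℕ => g (t.subtree [i])).comp
          (measurable_pi_apply (X := fun _ : ℕ => ℕ) 0)).aemeasurable
      · exact Eventually.of_forall fun ξ => (hg1 _).trans_lt ENNReal.one_lt_top
  have hgc : ∀ᵐ t ∂law p η, ∀ i, [i] ∈ t.verts → g (t.subtree [i]) = g t := by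
    filter_upwards [h.law_absolutelyContinuous hp0 hp1 hμ |>.ae_le hgr] with t ht i hi
    exact (ENNReal.toReal_eq_toReal_iff' ((hg1 _).trans_lt ENNReal.one_lt_top).ne
      ((hg1 _).trans_lt ENNReal.one_lt_top).ne).1 (ht i hi)
  -- Being constant along edges, `g` has inherited preimages of measurable sets, all trivial by the
  -- zero-one law.
  obtain ⟨c, hc⟩ : ∃ c, g =ᵐ[law p η] Function.const _ c := by
    refine exists_eventuallyEq_const_of_forall_separating MeasurableSet fun U hU => ?_
    rcases law_eq_zero_or_one p η hp0 hp1 (hgm hU) (by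
      filter_upwards [hgc] with t ht htU i hi
      rwa [Set.mem_preimage, ht i hi]) with h1 | h1
    · exact Or.inr (measure_eq_zero_iff_ae_notMem.1 h1)
    · exact Or.inl ((prob_compl_eq_zero_iff (hgm hU)).2 h1)
  have hcμ : ∀ᵐ t ∂μ, g t = c := hμ.ae_le hc
  have hcc : c = c * c := by
    obtain ⟨t, ⟨ht, hd⟩, htc⟩ := (((h.ae_subtree hcμ).and h.1.ae_mem_dom).and hcμ).exists
    have hsec : MeasurableSet (Prod.mk t ⁻¹' A) := measurable_prodMk_left hA
    -- Given the tree, `A` is independent of every cylinder: by invariance, membership depends only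
    -- on the pair seen from `x`, where its probability is again `c`. Testing on `A` itself gives `c
    -- = c * c`.
    have key : (Θ.rayLaw t).restrict (Prod.mk t ⁻¹' A) = c • Θ.rayLaw t := by
      refine measure_ext_of_wordCylinder fun x => ?_
      rw [Measure.restrict_apply (measurableSet_wordCylinder x), Measure.smul_apply, smul_eq_mul]
      by_cases hx : x ∈ t.verts
      · have hset : wordCylinder x ∩ Prod.mk t ⁻¹' A =
            wordCylinder x ∩ {ξ | (fun k => ξ (x.length + k)) ∈ Prod.mk (t.subtree x) ⁻¹' A} := by
          ext ξ
          refine and_congr_right fun hξ => ?_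
          rw [mem_wordCylinder] at hξ
          have hi := Function.IsFixedPt.preimage_iterate (f := rayShift) hinv x.length
          have h1 : (t, ξ) ∈ rayShift^[x.length] ⁻¹' A ↔ (t, ξ) ∈ A := by rw [hi]
          rw [Set.mem_preimage, iterate_rayShift (by rwa [hξ]), hξ] at h1
          exact h1.symm
        rw [hset, rayLaw_wordCylinder_inter hd hx (measurable_prodMk_left hA),
          show Θ.rayLaw (t.subtree x) (Prod.mk (t.subtree x) ⁻¹' A) = c from ht x hx,
          rayLaw_wordCylinder hd, mul_comm]
      · rw [rayLaw_wordCylinder_of_notMem hd hx, mul_zero]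
        exact measure_mono_null Set.inter_subset_left (rayLaw_wordCylinder_of_notMem hd hx)
    have h1 := congrArg (fun m => m (Prod.mk t ⁻¹' A)) key
    rw [Measure.restrict_apply hsec, Set.inter_self, Measure.smul_apply, smul_eq_mul] at h1
    rwa [show Θ.rayLaw t (Prod.mk t ⁻¹' A) = c from htc] at h1
  have hPA : (μ ⊗ₘ Θ.rayKernel) A = c := by
    rw [Measure.compProd_apply hA]
    change ∫⁻ t, g t ∂μ = c
    rw [lintegral_congr_ae hcμ, lintegral_const, measure_univ, mul_one]
  rw [eventuallyConst_set']
  have hcfin : c ≠ ∞ := hPA ▸ measure_ne_top _ _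
  by_cases hc0 : c = 0
  · exact Or.inl (ae_eq_empty.2 (hPA.trans hc0))
  · right
    have hc1 : c = 1 := by
      have : c * 1 = c * c := by rwa [mul_one]
      exact ((ENNReal.mul_right_inj hc0 hcfin).1 this).symm
    exact ae_eq_univ.2 ((prob_compl_eq_zero_iff hA).2 (hPA.trans hc1))

theorem ofFn_eq_wordTrunc (ξ : ℕ → ℕ) (n : ℕ) :
    List.ofFn (fun k : Fin n => ξ k) = wordTrunc ξ n := by
  apply List.ext_getElem <;> simp [wordTrunc]

theorem lintegral_wordTrunc_le (m : Measure (ℕ → ℕ)) (F : List ℕ → ℝ≥0∞) (n : ℕ) :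
    ∫⁻ ξ, F (wordTrunc ξ n) ∂m ≤
      ∑' x : Fin n → ℕ, F (List.ofFn x) * m (wordCylinder (List.ofFn x)) := by
  calc ∫⁻ ξ, F (wordTrunc ξ n) ∂m
      ≤ ∫⁻ ξ, ∑' x : Fin n → ℕ,
          (wordCylinder (List.ofFn x)).indicator (fun _ => F (List.ofFn x)) ξ ∂m := by
        refine lintegral_mono fun ξ => ?_
        refine le_trans ?_ (ENNReal.le_tsum (fun k : Fin n => ξ k))
        rw [ofFn_eq_wordTrunc, Set.indicator_of_mem (mem_wordCylinder_wordTrunc.2 rfl)]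
    _ = _ := by
        rw [lintegral_tsum fun x =>
          (measurable_const.indicator (measurableSet_wordCylinder _)).aemeasurable]
        refine tsum_congr fun x => ?_
        rw [lintegral_indicator_const (measurableSet_wordCylinder _)]

theorem measurable_rayLaw_wordTrunc (n : ℕ) : Measurable fun z : MarkedTree × (ℕ → ℕ) =>
    Θ.rayLaw z.1 (wordCylinder (wordTrunc z.2 n)) := by
  have h : Measurable fun q : MarkedTree × (Fin n → ℕ) =>
      Θ.rayLaw q.1 (wordCylinder (List.ofFn q.2)) :=
    measurable_from_prod_countable_left fun x =>
      (Measure.measurable_coe (measurableSet_wordCylinder (List.ofFn x))).comp measurable_rayLaw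
  have h2 : Measurable fun z : MarkedTree × (ℕ → ℕ) => (z.1, fun k : Fin n => z.2 k) := by
    fun_prop
  simpa only [Function.comp_def, ofFn_eq_wordTrunc] using h.comp h2

/-- The mass of the vertices along a ray decreases at most exponentially fast. -/
theorem exists_le_flow_wordTrunc (hm : ∑' k : ℕ, (k : ℝ≥0∞) * p k < ∞)
    (hΘ : Θ.IsRuleFor (law p η)) :
    ∃ C : ℝ, ∀ᵐ z ∂(law p η ⊗ₘ Θ.rayKernel), ∀ᶠ n : ℕ in atTop,
      -Real.log (Θ.flow z.1 (wordTrunc z.2 n)) ≤ C * n := by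
  have hprob := isProbabilityMeasure_law p η
  set M := ∑' i, p.toMeasure {k | i < max 1 k} with hM
  have hM1 : 1 ≤ M := one_le_tsum_max_one p
  have hMt : M ≠ ∞ := tsum_max_one_ne_top p hm
  have hM0 : M ≠ 0 := (zero_lt_one.trans_le hM1).ne'
  set R : ℕ → MarkedTree × (ℕ → ℕ) → ℝ≥0∞ :=
    fun n z => Θ.rayLaw z.1 (wordCylinder (wordTrunc z.2 n)) with hR
  have hRm : ∀ n, Measurable fun z => (R n z)⁻¹ := fun n => (measurable_rayLaw_wordTrunc n).inv
  -- For a fixed tree, each vertex at height `n` contributes its mass times the inverse mass, at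
  -- most `1`. The integral is thus bounded by the mean number of such vertices.
  have hbound : ∀ n, ∫⁻ z, (R n z)⁻¹ ∂(law p η ⊗ₘ Θ.rayKernel) ≤ M ^ n := by
    intro n
    rw [Measure.lintegral_compProd (hRm n), hM, ← tsum_law_mem p η n]
    have hind : ∀ x : Fin n → ℕ, law p η {t | List.ofFn x ∈ t.verts} =
        ∫⁻ t, {t : MarkedTree | List.ofFn x ∈ t.verts}.indicator 1 t ∂law p η := fun x =>
      (lintegral_indicator_one (MarkedTree.measurableSet_mem_verts _)).symm
    simp_rw [hind]
    rw [← lintegral_tsum fun x =>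
      (measurable_one.indicator (MarkedTree.measurableSet_mem_verts _)).aemeasurable]
    refine lintegral_mono_ae ?_
    filter_upwards [hΘ.ae_mem_dom] with t ht
    refine (lintegral_wordTrunc_le (Θ.rayLaw t)
      (fun x => (Θ.rayLaw t (wordCylinder x))⁻¹) n).trans (ENNReal.tsum_le_tsum fun x => ?_)
    by_cases hx : List.ofFn x ∈ t.verts
    · rw [Set.indicator_of_mem (s := {t : MarkedTree | List.ofFn x ∈ t.verts}) hx]
      exact ENNReal.inv_mul_le_one _
    · rw [rayLaw_wordCylinder_of_notMem ht hx, mul_zero]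
      exact zero_le
  -- The factor `2` leaves a geometric series of ratio `1/2`. Almost sure convergence then makes the
  -- masses eventually at least `(2 * M) ^ (-n)`, whence the constant `log (2 * M)`.
  have hsum : ∫⁻ z, ∑' n, (R n z)⁻¹ * ((2 * M) ^ n)⁻¹ ∂(law p η ⊗ₘ Θ.rayKernel) ≠ ∞ := by
    rw [lintegral_tsum fun n => ((hRm n).mul_const _).aemeasurable]
    refine ne_top_of_le_ne_top (b := ∑' n : ℕ, (2⁻¹ : ℝ≥0∞) ^ n) ?_ (ENNReal.tsum_le_tsum fun n => ?_)
    · rw [ENNReal.tsum_geometric]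
      simp
    · rw [lintegral_mul_const _ (hRm n)]
      calc _ ≤ M ^ n * ((2 * M) ^ n)⁻¹ := by gcongr; exact hbound n
        _ = 2⁻¹ ^ n := by
          rw [mul_pow, ENNReal.mul_inv (by simp) (by simp), mul_comm, mul_assoc,
            ENNReal.inv_mul_cancel (pow_ne_zero _ hM0) (ENNReal.pow_ne_top hMt), mul_one,
            ENNReal.inv_pow]
  refine ⟨Real.log (2 * M).toReal, ?_⟩
  have hdom : ∀ᵐ z ∂(law p η ⊗ₘ Θ.rayKernel), z.1 ∈ Θ.dom :=
    by
    refine ae_of_ae_map measurable_fst.aemeasurable ?_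
    change ∀ᵐ t ∂(law p η ⊗ₘ Θ.rayKernel).fst, t ∈ Θ.dom
    rw [Measure.fst_compProd]
    exact hΘ.ae_mem_dom
  filter_upwards [ae_lt_top (Measurable.tsum fun n => (hRm n).mul_const _) hsum, hdom]
    with z hz hd
  have hlim := ENNReal.tendsto_atTop_zero_of_tsum_ne_top hz.ne
  filter_upwards [hlim.eventually_le_const zero_lt_one] with n hn
  have h1 : ((2 * M) ^ n)⁻¹ ≤ R n z := by
    have hne : R n z ≠ ∞ := measure_ne_top _ _
    have h0 : R n z ≠ 0 := by
      intro h0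
      rw [h0, ENNReal.inv_zero, ENNReal.top_mul (ENNReal.inv_ne_zero.2
        (ENNReal.pow_ne_top (ENNReal.mul_ne_top (by simp) hMt)))] at hn
      exact absurd hn (by simp)
    calc ((2 * M) ^ n)⁻¹ = R n z * ((R n z)⁻¹ * ((2 * M) ^ n)⁻¹) := by
          rw [← mul_assoc, ENNReal.mul_inv_cancel h0 hne, one_mul]
      _ ≤ R n z * 1 := mul_le_mul_right hn _
      _ = R n z := mul_one _
  have hb : 0 < (2 * M).toReal :=
    ENNReal.toReal_pos (mul_ne_zero two_ne_zero hM0) (ENNReal.mul_ne_top (by simp) hMt)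
  have h2 : (((2 * M).toReal) ^ n)⁻¹ ≤ Θ.flow z.1 (wordTrunc z.2 n) := by
    have hpos : 0 < (((2 * M).toReal) ^ n)⁻¹ := inv_pos.2 (pow_pos hb n)
    rw [hR] at h1
    simp only [rayLaw_wordCylinder hd] at h1
    rw [← ENNReal.toReal_pow, ← ENNReal.toReal_inv] at hpos ⊢
    have h3 := (ENNReal.ofReal_toReal (ENNReal.toReal_pos_iff.1 hpos).2.ne).trans_le h1
    by_contra hcon
    exact absurd h3 (not_le.2 ((ENNReal.ofReal_lt_ofReal_iff hpos).2 (not_le.1 hcon)))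
  have h3 := Real.log_le_log (inv_pos.2 (pow_pos hb n)) h2
  rw [Real.log_inv, Real.log_pow] at h3
  linarith

end FlowRule

/-! ### First passage: from rates per height to a rate per logarithmic size, with inverses so that
`E = ∞` gives limit `0`. -/

theorem tendsto_toReal_inv_of_tendsto_ofReal {u : ℕ → ℝ} (hu : ∀ n, 0 ≤ u n) {E : ℝ≥0∞}
    (hE : E ≠ 0) (h : Tendsto (fun n => ENNReal.ofReal (u n)) atTop (𝓝 E)) :
    Tendsto (fun n => (u n)⁻¹) atTop (𝓝 (E⁻¹).toReal) := by
  have h1 := (ENNReal.tendsto_toReal (ENNReal.inv_ne_top.2 hE)).comp h.inv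
  refine h1.congr fun n => ?_
  simp [ENNReal.toReal_inv, ENNReal.toReal_ofReal (hu n)]

/-- If `a n / n → D` and `ℓ n / n → E`, then `a (N s) / s → D / E` as `s → ∞`, where `N s` is the
first index such that `s ≤ ℓ (N s)`. -/
theorem tendsto_div_of_first_passage {a ℓ : ℕ → ℝ} {D : ℝ} {E : ℝ≥0∞} (ha : ∀ n, 0 ≤ a n)
    (hℓ : Monotone ℓ) (hℓ0 : ∀ n, 0 ≤ ℓ n) (hE : E ≠ 0)
    (haD : Tendsto (fun n : ℕ => a n / n) atTop (𝓝 D))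
    (hℓE : Tendsto (fun n : ℕ => ENNReal.ofReal (ℓ n / n)) atTop (𝓝 E)) {N : ℝ → ℕ}
    (hN : ∀ s, s ≤ ℓ (N s)) (hN' : ∀ s, ∀ n < N s, ℓ n < s) :
    Tendsto (fun s => a (N s) / s) atTop (𝓝 (D * (E⁻¹).toReal)) := by
  have hinv : Tendsto (fun n : ℕ => (ℓ n / n)⁻¹) atTop (𝓝 (E⁻¹).toReal) :=
    tendsto_toReal_inv_of_tendsto_ofReal (fun n => div_nonneg (hℓ0 n) n.cast_nonneg) hE hℓE
  have hNtop : Tendsto N atTop atTop := by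
    refine tendsto_atTop.2 fun m => ?_
    filter_upwards [eventually_gt_atTop (ℓ m)] with s hs
    by_contra hcon
    exact absurd (hs.trans_le (hN s)) (not_lt.2 (hℓ (not_le.1 hcon).le))
  have hlow : Tendsto (fun n : ℕ => a n / ℓ n) atTop (𝓝 (D * (E⁻¹).toReal)) := by
    refine (haD.mul hinv).congr' ?_
    filter_upwards [eventually_gt_atTop 0] with n hn
    have : (n : ℝ) ≠ 0 := by exact_mod_cast hn.ne'
    rw [inv_div]
    field_simp
  have hup : Tendsto (fun n : ℕ => a n / ℓ (n - 1)) atTop (𝓝 (D * (E⁻¹).toReal)) := by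
    rw [← tendsto_add_atTop_iff_nat 1]
    have h1 : Tendsto (fun n : ℕ => a (n + 1) / ((n + 1 : ℕ) : ℝ)) atTop (𝓝 D) :=
      (tendsto_add_atTop_iff_nat 1).2 haD
    have h2 : Tendsto (fun n : ℕ => ((n + 1 : ℕ) : ℝ) / n) atTop (𝓝 1) := by
      have h3 : Tendsto (fun n : ℕ => 1 + 1 / (n : ℝ)) atTop (𝓝 (1 + 0)) :=
        tendsto_const_nhds.add tendsto_one_div_atTop_nhds_zero_nat
      rw [add_zero] at h3
      refine h3.congr' ?_
      filter_upwards [eventually_gt_atTop 0] with n hn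
      have : (n : ℝ) ≠ 0 := by exact_mod_cast hn.ne'
      push_cast
      field_simp
    have h3 := (h1.mul h2).mul hinv
    rw [mul_one] at h3
    refine h3.congr' ?_
    filter_upwards [eventually_gt_atTop 0] with n hn
    have h4 : (n : ℝ) ≠ 0 := by exact_mod_cast hn.ne'
    have h5 : ((n + 1 : ℕ) : ℝ) ≠ 0 := by positivity
    rw [inv_div, Nat.add_sub_cancel]
    field_simp
  have hℓtop : ∃ m, 0 < ℓ m := by
    by_contra! hcon
    refine hE (tendsto_nhds_unique hℓE ?_)
    refine tendsto_const_nhds.congr fun n => ?_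
    rw [le_antisymm (hcon n) (hℓ0 n), zero_div, ENNReal.ofReal_zero]
  obtain ⟨m, hm⟩ := hℓtop
  -- The sandwich is `ℓ (N s - 1) < s ≤ ℓ (N s)`; the index `m` keeps the smaller denominator
  -- positive.
  refine tendsto_of_tendsto_of_tendsto_of_le_of_le' (hlow.comp hNtop) (hup.comp hNtop) ?_ ?_
  · filter_upwards [eventually_gt_atTop 0] with s hs
    exact div_le_div_of_nonneg_left (ha _) hs (hN s)
  · filter_upwards [hNtop.eventually_ge_atTop (m + 1)] with s hs
    refine div_le_div_of_nonneg_left (ha _) ?_ (hN' s _ (by omega)).le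
    exact hm.trans_le (hℓ (by omega))

/-! ### Balls as cylinders, and the dimension of a flow. -/

namespace MarkedTree

variable {t : MarkedTree}

theorem measurableSet_boundary (t : MarkedTree) : MeasurableSet t.boundary := by
  have : t.boundary = ⋂ n, {ξ | wordTrunc ξ n ∈ t.verts} := by
    ext
    simp [boundary]
  rw [this]
  exact MeasurableSet.iInter fun n => measurableSet_setOfPred.2 (measurable_comp_wordTrunc _ n)

theorem wordTrunc_eq_iff_le_firstDiff {ξ ζ : ℕ → ℕ} (h : ζ ≠ ξ) {n : ℕ} :
    wordTrunc ζ n = wordTrunc ξ n ↔ n ≤ PiNat.firstDiff ξ ζ := by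
  rw [wordTrunc_eq_iff]
  constructor
  · intro hk
    by_contra hcon
    exact PiNat.apply_firstDiff_ne h.symm (hk _ (not_le.1 hcon)).symm
  · intro hn k hk
    exact (PiNat.apply_eq_of_lt_firstDiff (hk.trans_le hn)).symm

end MarkedTree

namespace FlowRule

variable {Θ : FlowRule} {t : MarkedTree}

/-- If the distance from a typical ray `ξ` is `exp (-ℓ n)` for the rays which leave it at height `n`,
where `ℓ n / n → E`, and if the mass of the vertices of `ξ` decreases at exponential speed `D`, then
the flow has dimension `D / E`. -/
theorem flowExactDimensional (ht : t ∈ Θ.dom) {d : t.boundary → t.boundary → ℝ} {D E : ℝ≥0∞}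
    (hD : D ≠ ∞) (hE : E ≠ 0) (hd0 : ∀ ξ, d ξ ξ = 0) {ℓ : (ℕ → ℕ) → ℕ → ℝ}
    (hd : ∀ ξ ζ : t.boundary, ζ ≠ ξ → d ξ ζ = Real.exp (-ℓ ξ (PiNat.firstDiff ξ.1 ζ.1)))
    (hmono : ∀ ξ : t.boundary, Monotone (ℓ ξ)) (hnonneg : ∀ (ξ : t.boundary) n, 0 ≤ ℓ ξ n)
    (hℓ : ∀ᵐ ξ ∂Θ.rayLaw t, Tendsto (fun n : ℕ => ENNReal.ofReal (ℓ ξ n / n)) atTop (𝓝 E))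
    (hflow : ∀ᵐ ξ ∂Θ.rayLaw t, Tendsto
      (fun n : ℕ => ENNReal.ofReal (-Real.log (Θ.flow t (wordTrunc ξ n)) / n)) atTop (𝓝 D)) :
    t.FlowExactDimensional d (Θ.flow t) (D / E) := by
  have hemb : MeasurableEmbedding (Subtype.val : t.boundary → ℕ → ℕ) :=
    MeasurableEmbedding.subtype_coe t.measurableSet_boundary
  -- The ray law is carried by the boundary, so restricting it there loses no mass.
  have hcyl : ∀ (A : Set t.boundary) (x : List ℕ),
      (∀ ζ : t.boundary, ζ ∈ A ↔ ζ.1 ∈ wordCylinder x) →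
      (Θ.rayLaw t).comap (Subtype.val : t.boundary → ℕ → ℕ) A = ENNReal.ofReal (Θ.flow t x) := by
    intro A x hA
    rw [hemb.comap_apply, ← rayLaw_wordCylinder ht]
    refine measure_congr ?_
    filter_upwards [ae_mem_boundary ht] with ξ hξ
    refine propext ⟨?_, fun h => ⟨⟨ξ, hξ⟩, (hA _).2 h, rfl⟩⟩
    rintro ⟨ζ, hζ, rfl⟩
    exact (hA ζ).1 hζ
  refine ⟨(Θ.rayLaw t).comap Subtype.val, fun x _ => hcyl _ x fun ζ => Iff.rfl, ⟨?_⟩, ?_⟩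
  · rw [hcyl Set.univ [] (by simp), (Θ.isFlow t ht).root, ENNReal.ofReal_one]
  have hae : ∀ᵐ ξ : t.boundary ∂(Θ.rayLaw t).comap Subtype.val,
      Tendsto (fun n : ℕ => ENNReal.ofReal (ℓ ξ n / n)) atTop (𝓝 E) ∧
      Tendsto (fun n : ℕ => ENNReal.ofReal (-Real.log (Θ.flow t (wordTrunc ξ n)) / n)) atTop
        (𝓝 D) := by
    rw [ae_iff, hemb.comap_apply]
    refine measure_mono_null ?_ (ae_iff.1 (hℓ.and hflow))
    rintro _ ⟨ξ, hξ, rfl⟩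
    exact hξ
  filter_upwards [hae] with ξ ⟨h1, h2⟩
  have hpos : ∀ n, 0 < Θ.flow t (wordTrunc ξ n) := fun n => Θ.pos t ht _ (ξ.2 n)
  have hle : ∀ n, 0 ≤ -Real.log (Θ.flow t (wordTrunc ξ n)) := fun n =>
    neg_nonneg.2 (Real.log_nonpos (hpos n).le ((Θ.isFlow t ht).mem_Icc _ (ξ.2 n)).2)
  have h3 : Tendsto (fun n : ℕ => -Real.log (Θ.flow t (wordTrunc ξ n)) / n) atTop
      (𝓝 D.toReal) := by
    refine ((ENNReal.tendsto_toReal hD).comp h2).congr fun n => ?_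
    exact ENNReal.toReal_ofReal (div_nonneg (hle n) n.cast_nonneg)
  -- If `ℓ` stayed below `s`, then `ℓ n / n` would tend to `0`, against `E ≠ 0`.
  have hex : ∀ s : ℝ, ∃ n, s ≤ ℓ ξ n := by
    intro s
    by_contra! hcon
    refine hE (tendsto_nhds_unique h1 ?_)
    have h4 : Tendsto (fun n : ℕ => ENNReal.ofReal (s / n)) atTop (𝓝 0) := by
      have := ENNReal.tendsto_ofReal (tendsto_const_div_atTop_nhds_zero_nat s)
      rwa [ENNReal.ofReal_zero] at this
    refine tendsto_of_tendsto_of_tendsto_of_le_of_le tendsto_const_nhds h4 (fun n => zero_le)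
      fun n => ENNReal.ofReal_le_ofReal ?_
    exact div_le_div_of_nonneg_right (hcon n).le n.cast_nonneg
  classical
  set N : ℝ → ℕ := fun s => Nat.find (hex s) with hN
  have hlim := tendsto_div_of_first_passage hle (hmono ξ) (hnonneg ξ) hE h3 h1
    (N := N) (fun s => Nat.find_spec (hex s)) (fun s n hn => not_le.1 (Nat.find_min (hex s) hn))
  have hlog : Tendsto (fun r : ℝ => -Real.log r) (𝓝[>] 0) atTop :=
    tendsto_neg_atBot_atTop.comp Real.tendsto_log_nhdsGT_zero
  have hDE : (D / E : ℝ≥0∞) ≠ ∞ := ENNReal.div_ne_top hD hE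
  have hgoal : ((D / E : ℝ≥0∞) : EReal) = ((D.toReal * (E⁻¹).toReal : ℝ) : EReal) := by
    rw [← ENNReal.toReal_mul, ← div_eq_mul_inv, EReal.coe_ennreal_toReal hDE]
  rw [hgoal]
  refine ((continuous_coe_real_ereal.tendsto _).comp (hlim.comp hlog)).congr' ?_
  filter_upwards [self_mem_nhdsWithin] with r hr
  -- By monotonicity of `ℓ`, a ray is within `r` of `ξ` exactly when it leaves `ξ` no earlier than
  -- the first height where `ℓ` reaches `-log r`.
  have hball : (Θ.rayLaw t).comap Subtype.val {ζ | d ξ ζ ≤ r} =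
      ENNReal.ofReal (Θ.flow t (wordTrunc ξ (N (-Real.log r)))) := by
    refine hcyl _ _ fun ζ => ?_
    rw [mem_wordCylinder_wordTrunc, Set.mem_ofPred_eq]
    by_cases hζ : ζ = ξ
    · subst hζ
      simp only [hd0, iff_true]
      exact (Set.mem_Ioi.1 hr).le
    · rw [MarkedTree.wordTrunc_eq_iff_le_firstDiff fun h => hζ (Subtype.ext h), hd ξ ζ hζ,
        ← Real.le_log_iff_exp_le hr, neg_le, hN, Nat.find_le_iff]
      exact ⟨fun h => ⟨_, le_rfl, h⟩, fun ⟨m, hm, h⟩ => h.trans (hmono ξ hm)⟩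
  rw [hball, ENNReal.log_ofReal_of_pos (hpos _)]
  simp only [Function.comp_apply, EReal.coe_div, EReal.coe_neg]

end FlowRule

/-! ### Logarithmic losses as Birkhoff sums. -/

namespace MarkedTree

/-- The contribution `-log (1 - 1 / γ)` of the mark of the root to the logarithm of the length
distance. -/
noncomputable def markLoss (t : MarkedTree) : ℝ := -Real.log (1 - (t.mark [] : ℝ)⁻¹)

theorem measurable_markLoss : Measurable markLoss :=
  (Real.measurable_log.comp
    (measurable_const.sub (measurable_mark []).coe_nnreal_real.inv)).neg

variable {t : MarkedTree}

theorem one_sub_inv_mem_Ioo {γ : ℝ≥0} (h : 1 < γ) : (1 - (γ : ℝ)⁻¹) ∈ Set.Ioo (0 : ℝ) 1 := by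
  have h1 : (1 : ℝ) < γ := by exact_mod_cast h
  exact ⟨sub_pos.2 (inv_lt_one_of_one_lt₀ h1), sub_lt_self _ (inv_pos.2 (by linarith))⟩

theorem markLoss_pos (h : 1 < t.mark []) : 0 < t.markLoss :=
  neg_pos.2 (Real.log_neg (one_sub_inv_mem_Ioo h).1 (one_sub_inv_mem_Ioo h).2)

/-- Telescoping: it turns one minus the `Γ`-height into a product, whose logarithm is additive along
the ray. -/
theorem one_sub_sum_prod_mul (c : ℕ → ℝ) (n : ℕ) :
    1 - ∑ k ∈ Finset.range n, (∏ j ∈ Finset.range k, (1 - c j)) * c k =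
      ∏ j ∈ Finset.range n, (1 - c j) := by
  induction n with
  | zero => simp
  | succ n ih => rw [Finset.sum_range_succ, Finset.prod_range_succ, ← sub_sub, ih]; ring

/-- The logarithmic size, for the length distance, of the vertex of height `n` of a ray. -/
noncomputable def lossSum (t : MarkedTree) (ξ : ℕ → ℕ) (n : ℕ) : ℝ :=
  ∑ k ∈ Finset.range (n + 1), (t.subtree (wordTrunc ξ k)).markLoss

theorem markLoss_subtree {x : List ℕ} (hx : x ∈ t.verts) :
    (t.subtree x).markLoss = -Real.log (1 - (t.mark x : ℝ)⁻¹) := by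
  rw [markLoss, mark_subtree hx, List.append_nil]

theorem gammaDist_eq_exp (hmark : ∀ x ∈ t.verts, 1 < t.mark x) {ξ ζ : t.boundary} (h : ζ ≠ ξ) :
    t.gammaDist ξ ζ = Real.exp (-t.lossSum ξ (PiNat.firstDiff ξ.1 ζ.1)) := by
  rw [gammaDist, if_neg h.symm, gammaHeight, length_wordTrunc]
  set n := PiNat.firstDiff ξ.1 ζ.1
  have h1 : ∀ k ∈ Finset.range (n + 1),
      (∏ j ∈ Finset.range k, (1 - (t.mark ((wordTrunc ξ n).take j) : ℝ)⁻¹)) *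
        (t.mark ((wordTrunc ξ n).take k) : ℝ)⁻¹ =
      (∏ j ∈ Finset.range k, (1 - (t.mark (wordTrunc ξ j) : ℝ)⁻¹)) *
        (t.mark (wordTrunc ξ k) : ℝ)⁻¹ := by
    intro k hk
    have hk' : k ≤ n := Nat.lt_succ_iff.1 (Finset.mem_range.1 hk)
    rw [take_wordTrunc _ hk']
    congr 1
    refine Finset.prod_congr rfl fun j hj => ?_
    rw [take_wordTrunc _ ((Finset.mem_range.1 hj).le.trans hk')]
  rw [Finset.sum_congr rfl h1, one_sub_sum_prod_mul (fun k => (t.mark (wordTrunc ξ k) : ℝ)⁻¹),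
    lossSum, ← Finset.sum_neg_distrib, Real.exp_sum]
  refine Finset.prod_congr rfl fun j _ => ?_
  rw [markLoss_subtree (ξ.2 j), neg_neg,
    Real.exp_log (one_sub_inv_mem_Ioo (hmark _ (ξ.2 j))).1]

end MarkedTree

namespace FlowRule

open ProbabilityTheory GaltonWatson MarkedTree

variable (Θ : FlowRule)

/-- Minus the logarithm of the mass of the first vertex of a ray. -/
noncomputable def flowLoss (z : MarkedTree × (ℕ → ℕ)) : ℝ :=
  -- Expressed through `rayLaw`, which is measurable on all trees, whereas `flow` is arbitrary off
  -- the domain.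
  -Real.log (Θ.rayLaw z.1 (wordCylinder (wordTrunc z.2 1))).toReal

variable {Θ} {t : MarkedTree} {ξ : ℕ → ℕ}

theorem measurable_flowLoss : Measurable Θ.flowLoss :=
  (Real.measurable_log.comp (measurable_rayLaw_wordTrunc 1).ennreal_toReal).neg

theorem flowLoss_nonneg (z : MarkedTree × (ℕ → ℕ)) : 0 ≤ Θ.flowLoss z :=
  neg_nonneg.2 (Real.log_nonpos ENNReal.toReal_nonneg
    (ENNReal.toReal_le_of_le_ofReal zero_le_one (by simpa using prob_le_one)))

/-- Consistency makes the flow multiplicative along the ray, so its logarithm is an additive cocycle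
of the shift. -/
theorem birkhoffSum_flowLoss (ht : t ∈ Θ.dom) (hξ : ξ ∈ t.boundary) (n : ℕ) :
    birkhoffSum rayShift Θ.flowLoss n (t, ξ) = -Real.log (Θ.flow t (wordTrunc ξ n)) := by
  induction n with
  | zero => simp [(Θ.isFlow t ht).root]
  | succ n ih =>
    have hn := Θ.subtree_mem t ht _ (hξ n)
    have h1 := flow_append ht (hξ n) [ξ n]
    rw [← wordTrunc_succ] at h1
    have hpos := Θ.pos t ht _ (hξ (n + 1))
    have hpos' := Θ.pos t ht _ (hξ n)
    have hpos2 : 0 < Θ.flow (t.subtree (wordTrunc ξ n)) [ξ n] := by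
      rw [h1] at hpos
      exact pos_of_mul_pos_right hpos hpos'.le
    have h2 : wordTrunc (fun k => ξ (n + k)) 1 = [ξ n] := by simp [wordTrunc]
    rw [birkhoffSum_succ, ih, iterate_rayShift (hξ n), flowLoss, h2, rayLaw_wordCylinder hn,
      ENNReal.toReal_ofReal hpos2.le, h1, Real.log_mul hpos'.ne' hpos2.ne']
    ring

/-- There are `n + 1` terms since both the root and the vertex at height `n` count. The maximum with
`0` gives the everywhere nonnegative function required by the ergodic theorem, and changes nothing
when marks exceed `1`. -/
theorem birkhoffSum_markLoss (hmark : ∀ x ∈ t.verts, 1 < t.mark x) (hξ : ξ ∈ t.boundary) (n : ℕ) :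
    birkhoffSum rayShift (fun z => max 0 z.1.markLoss) (n + 1) (t, ξ) = t.lossSum ξ n := by
  rw [birkhoffSum, lossSum]
  refine Finset.sum_congr rfl fun k _ => ?_
  rw [iterate_rayShift (hξ k)]
  refine max_eq_right (markLoss_pos ?_).le
  rw [mark_subtree (hξ k), List.append_nil]
  exact hmark _ (hξ k)

end FlowRule

theorem tendsto_ofReal_succ_div {u : ℕ → ℝ} {E : ℝ≥0∞}
    (h : Tendsto (fun n : ℕ => ENNReal.ofReal (u n / n)) atTop (𝓝 E)) :
    Tendsto (fun n : ℕ => ENNReal.ofReal (u (n + 1) / n)) atTop (𝓝 E) := by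
  have h1 : Tendsto (fun n : ℕ => ENNReal.ofReal (u (n + 1) / ((n + 1 : ℕ) : ℝ))) atTop (𝓝 E) :=
    (tendsto_add_atTop_iff_nat (f := fun n : ℕ => ENNReal.ofReal (u n / n)) 1).2 h
  have h2 : Tendsto (fun n : ℕ => ENNReal.ofReal (1 + 1 / (n : ℝ))) atTop (𝓝 1) := by
    have h3 : Tendsto (fun n : ℕ => 1 + 1 / (n : ℝ)) atTop (𝓝 (1 + 0)) :=
      tendsto_const_nhds.add tendsto_one_div_atTop_nhds_zero_nat
    rw [add_zero] at h3
    simpa using ENNReal.tendsto_ofReal h3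
  have h3 := ENNReal.Tendsto.mul h1 (Or.inr ENNReal.one_ne_top) h2 (Or.inl one_ne_zero)
  rw [mul_one] at h3
  refine h3.congr' ?_
  filter_upwards [eventually_gt_atTop 0] with n hn
  have h4 : (n : ℝ) ≠ 0 := by exact_mod_cast hn.ne'
  rw [← ENNReal.ofReal_mul' (by positivity)]
  congr 1
  push_cast
  field_simp

/-! ### Conclusion. -/

open ProbabilityTheory GaltonWatson MarkedTree FlowRule in
theorem proposition5p4
    (p : PMF ℕ) (hp0 : p 0 = 0) (hp1 : p 1 < 1) (hm : ∑' k : ℕ, (k : ℝ≥0∞) * p k < ∞)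
    (η : Measure ℝ≥0) [IsProbabilityMeasure η] (hη : ∀ᵐ γ ∂η, 1 < γ)
    (Θ : FlowRule) (hΘ : Θ.IsRuleFor (GaltonWatson.law p η))
    (μ : Measure MarkedTree) [IsProbabilityMeasure μ]
    (hμ : μ ≪ GaltonWatson.law p η) (hinv : Θ.IsInvariant μ) :
    ∃ D : ℝ≥0∞, D ≠ ∞ ∧
      (∫⁻ t, ENNReal.ofReal (-Real.log (1 - (t.mark [] : ℝ)⁻¹)) ∂μ) ≠ 0 ∧
      (∀ᵐ t ∂(GaltonWatson.law p η), t.FlowExactDimensional t.natDist (Θ.flow t) D) ∧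
      (∀ᵐ t ∂(GaltonWatson.law p η), t.FlowExactDimensional t.gammaDist (Θ.flow t)
        (D / (∫⁻ t', ENNReal.ofReal (-Real.log (1 - (t'.mark [] : ℝ)⁻¹)) ∂μ))) := by
  have hprob := isProbabilityMeasure_law p η
  have hνμ := hinv.law_absolutelyContinuous hp0 hp1 hμ
  have herg := hinv.ergodic_rayShift hp0 hp1 hμ
  change ∃ D : ℝ≥0∞, D ≠ ∞ ∧ (∫⁻ t : MarkedTree, ENNReal.ofReal t.markLoss ∂μ) ≠ 0 ∧ _ ∧
    (∀ᵐ t ∂law p η, t.FlowExactDimensional t.gammaDist (Θ.flow t)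
      (D / ∫⁻ t : MarkedTree, ENNReal.ofReal t.markLoss ∂μ))
  set E := ∫⁻ t : MarkedTree, ENNReal.ofReal t.markLoss ∂μ with hEdef
  set D := ∫⁻ z, ENNReal.ofReal (Θ.flowLoss z) ∂(μ ⊗ₘ Θ.rayKernel)
  have hroot : ∀ᵐ t ∂law p η, 1 < t.mark [] := by
    refine (ae_map_iff measurable_tree.aemeasurable
      (measurableSet_lt measurable_const (measurable_mark []))).2 ?_
    have h1 : ∀ᵐ z ∂p.toMeasure.prod η, 1 < z.2 :=
      Measure.quasiMeasurePreserving_snd.ae hη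
    have h2 := (measurePreserving_eval_infinitePi (fun _ : List ℕ => p.toMeasure.prod η)
      []).quasiMeasurePreserving.ae h1
    filter_upwards [h2] with ω hω
    rwa [mark_tree, if_pos (root_mem _)]
  -- The property of the root mark passes to `μ`, spreads to all vertices by invariance, and returns
  -- by equivalence of the measures.
  have hmark : ∀ᵐ t ∂law p η, ∀ x ∈ t.verts, 1 < t.mark x := by
    filter_upwards [hνμ.ae_le (hinv.ae_subtree (hμ.ae_le hroot))] with t ht x hx
    have := ht x hx
    rwa [mark_subtree hx, List.append_nil] at this
  have hE : E ≠ 0 := by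
    rw [hEdef, Ne, lintegral_eq_zero_iff measurable_markLoss.ennreal_ofReal]
    intro h0
    have hrootμ : ∀ᵐ t ∂μ, 1 < t.mark [] := hμ.ae_le hroot
    obtain ⟨t, h1, h2⟩ := (hrootμ.and h0).exists
    exact (ENNReal.ofReal_pos.2 (markLoss_pos h1)).ne' h2
  have hlossm : Measurable fun z : MarkedTree × (ℕ → ℕ) => max 0 z.1.markLoss :=
    measurable_const.max (measurable_markLoss.comp measurable_fst)
  have hEP : ∫⁻ z, ENNReal.ofReal (max 0 z.1.markLoss) ∂(μ ⊗ₘ Θ.rayKernel) = E := by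
    rw [Measure.lintegral_compProd hlossm.ennreal_ofReal]
    refine lintegral_congr fun t => ?_
    dsimp only
    rw [lintegral_const, measure_univ, mul_one]
    rcases le_total 0 t.markLoss with h | h
    · rw [max_eq_right h]
    · rw [max_eq_left h, ENNReal.ofReal_zero, ENNReal.ofReal_of_nonpos h]
  have hflow : ∀ᵐ t ∂law p η, ∀ᵐ ξ ∂Θ.rayLaw t, Tendsto
      (fun n : ℕ => ENNReal.ofReal (-Real.log (Θ.flow t (wordTrunc ξ n)) / n)) atTop (𝓝 D) := by
    have h1 := Measure.ae_ae_of_ae_compProd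
      (herg.ae_tendsto_birkhoffAverage (measurable_flowLoss (Θ := Θ)) flowLoss_nonneg)
    filter_upwards [hνμ.ae_le h1, hΘ.ae_mem_dom] with t ht hd
    filter_upwards [show ∀ᵐ ξ ∂Θ.rayLaw t, _ from ht, ae_mem_boundary hd] with ξ hξ hb
    simpa only [birkhoffSum_flowLoss hd hb] using hξ
  have hloss : ∀ᵐ t ∂law p η, ∀ᵐ ξ ∂Θ.rayLaw t,
      Tendsto (fun n : ℕ => ENNReal.ofReal (t.lossSum ξ n / n)) atTop (𝓝 E) := by
    have h1 := Measure.ae_ae_of_ae_compProd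
      (herg.ae_tendsto_birkhoffAverage hlossm fun _ => le_max_left _ _)
    rw [hEP] at h1
    filter_upwards [hνμ.ae_le h1, hΘ.ae_mem_dom, hmark] with t ht hd htm
    filter_upwards [show ∀ᵐ ξ ∂Θ.rayLaw t, _ from ht, ae_mem_boundary hd] with ξ hξ hb
    simpa only [birkhoffSum_markLoss htm hb] using tendsto_ofReal_succ_div hξ
  -- `D` is the almost sure limit of the averages, so the exponential lower bound on the masses
  -- bounds it on one typical pair.
  have hD : D ≠ ∞ := by
    obtain ⟨C, hC⟩ := exists_le_flow_wordTrunc hm hΘ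
    obtain ⟨t, h1, h2⟩ := (hflow.and (Measure.ae_ae_of_ae_compProd hC)).exists
    obtain ⟨ξ, h3, h4⟩ := (h1.and (show ∀ᵐ ξ ∂Θ.rayLaw t, _ from h2)).exists
    refine ne_top_of_le_ne_top (ENNReal.ofReal_ne_top (r := C)) (le_of_tendsto h3 ?_)
    filter_upwards [h4, eventually_gt_atTop 0] with n hn hn0
    exact ENNReal.ofReal_le_ofReal ((div_le_iff₀ (by exact_mod_cast hn0)).2 hn)
  refine ⟨D, hD, hE, ?_, ?_⟩
  · filter_upwards [hflow, hΘ.ae_mem_dom] with t ht hd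
    -- For the natural distance the logarithmic size is the height itself, of rate `1`.
    have h1 := flowExactDimensional (d := t.natDist) (E := 1) (ℓ := fun _ n => n) hd hD one_ne_zero
      (fun ξ => if_pos rfl) (fun ξ ζ h => if_neg h.symm) (fun _ => Nat.mono_cast)
      (fun _ n => n.cast_nonneg) (Eventually.of_forall fun ξ => ?_) ht
    · rwa [div_one] at h1
    · refine tendsto_const_nhds.congr' ?_
      filter_upwards [eventually_gt_atTop 0] with n hn
      rw [div_self (by exact_mod_cast hn.ne'), ENNReal.ofReal_one]
  · filter_upwards [hflow, hloss, hmark, hΘ.ae_mem_dom] with t ht hl htm hd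
    have hpos : ∀ (ξ : t.boundary) k, 0 ≤ (t.subtree (wordTrunc ξ k)).markLoss := fun ξ k => by
      refine (markLoss_pos ?_).le
      rw [mark_subtree (ξ.2 k), List.append_nil]
      exact htm _ (ξ.2 k)
    exact flowExactDimensional hd hD hE (fun ξ => if_pos rfl)
      (fun ξ ζ h => gammaDist_eq_exp htm h)
      (fun ξ => monotone_nat_of_le_succ fun n => by
        rw [lossSum, lossSum, Finset.sum_range_succ _ (n + 1)]
        exact le_add_of_nonneg_right (hpos ξ _))
      (fun ξ n => Finset.sum_nonneg fun k _ => hpos ξ k) hl ht
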